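/- Let $\mathfrak n$ be a two-step nilpotent real Lie algebra with a basis $Z_1,\dots,Z_{n-2d},Y_1,\dots,Y_d,X_1,\dots,X_d$ ($d\ge 1$) such that the $Z_k$ span the center of $\mathfrak n$, $[Y_i,Y_j]=[X_i,X_j]=0$ for all $i,j$, and some linear functional $f$ on $\mathfrak n$ satisfies: $f([v,\cdot])=0$ if and only if $v$ is central. Let $N=\exp\mathfrak n$ be the connected, simply connected Lie group of $\mathfrak n$, with Haar measure $dz\,dy\,dx$ in the coordinates $\exp(\sum_k z_kZ_k)\exp(\sum_j y_jY_j)\exp(\sum_j x_jX_j)$, and let $L$ be its left regular representation on $L^2(N)$, $(L(g)f)(n)=f(g^{-1}n)$. Identify $\lambda\in\mathbb R^{n-2d}$ with the linear functional on $\mathfrak n$ with $Z_k\mapsto\lambda_k$, $Y_j\mapsto 0$, $X_j\mapsto 0$. Let $B(\lambda)=(-\lambda([X_i,Y_j]))_{1\le i,j\le d}$, let $V(\lambda)=(\lambda([E_i,E_j]))_{1\le i,j\le 2d}$ with $(E_1,\dots,E_{2d})=(Y_1,\dots,Y_d,X_1,\dots,X_d)$, let $\Sigma=\{\lambda\in\mathbb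 R^{n-2d}:\det V(\lambda)\neq 0\}$, and let $d\mu(\lambda)=|\det B(\lambda)|\,d\lambda$ be the Plancherel measure on $\Sigma$. For $\lambda\in\Sigma$ let $\pi_\lambda$ be the representation of $N$ on $L^2(\mathbb R^d)$ given by $$\pi_\lambda\Big(\exp\big(\textstyle\sum z_kZ_k\big)\exp\big(\sum y_jY_j\big)\exp\big(\sum x_jX_j\big)\Big)F(t)=e^{2\pi i(\langle\lambda,z\rangle+\langle t,B(\lambda)y\rangle)}F(t-x).$$ Let $\mathcal P:L^2(N)\to\int_\Sigma^\oplus L^2(\mathbb R^d)\otimes L^2(\mathbb R^d)\,d\mu(\lambda)$ be the Plancherel transform, that is, the continuous extension of $f\mapsto\big(\int_N f(n)\pi_\lambda(n)\,dn\big)_{\lambda\in\Sigma}$ from $L^1(N)\cap L^2(N)$; here $L^2(\mathbb R^d)\otimes L^2(\mathbb R^d)$ is the space of Hilbert–Schmidt operators on $L^2(\mathbb R^d)$, and $v\otimes u$ is the operator $h\mapsto\langle h,u\rangle v$. Let $a=(a_1,\dots,a_{n-2d})$, $q=(q_1,\dots,q_d)$, $b=(b_1,\dots,b_d)$ have strictly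 positive entries, and let $$\Gamma_{a,q,b}=\Big\{\exp\Big(\sum_k\tfrac{m_k}{a_k}Z_k\Big)\exp\Big(\sum_j\tfrac{k_j}{q_j}Y_j\Big)\exp\Big(\sum_j\tfrac{n_j}{b_j}X_j\Big):m_k,k_j,n_j\in\mathbb Z\Big\}.$$ Let $\mathbf I\subseteq\{\lambda\in\Sigma:0\le\lambda_k\le a_k\text{ for all }k\}$ be measurable, let $\mathbf u\in L^2(\mathbb R^d)$ be a unit vector, and let $$\mathcal H=\mathcal P^{-1}\Big(\int_{\mathbf I}^\oplus L^2(\mathbb R^d)\otimes\mathbf u\;d\mu(\lambda)\Big).$$ If there exists $\eta\in L^2(N)$ such that $\{L(\gamma)\eta\}_{\gamma\in\Gamma_{a,q,b}}$ is a Parseval frame in $\mathcal H$ (that is, all $L(\gamma)\eta$ lie in $\mathcal H$ and $\sum_{\gamma}|\langle\psi,L(\gamma)\eta\rangle|^2=\|\psi\|^2$ for every $\psi\in\mathcal H$), then $$\mu(\mathbf I)\le(q_1\cdots q_d)(b_1\cdots b_d)(a_1\cdots a_{n-2d}).$$ -/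

import Mathlib

open MeasureTheory Matrix
open scoped ENNReal

noncomputable section

/-- The Lie bracket is two-step nilpotent: `[[x, y], z] = 0` for all `x, y, z`. -/
class TwoStepLie (𝔫 : Type*) [LieRing 𝔫] : Prop where
  lie_lie_eq_zero : ∀ x y z : 𝔫, ⁅⁅x, y⁆, z⁆ = 0

/-- The connected, simply connected Lie group `N = exp 𝔫` of a two-step nilpotent Lie algebra `𝔫`:
its underlying manifold is `𝔫` and `exp` is the identity chart. -/
@[ext] structure NilGroup (𝔫 : Type*) where
  /-- the exponential map -/
  exp ::
  /-- the logarithm, inverse of the exponential map -/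
  log : 𝔫

namespace NilGroup

variable {𝔫 : Type*} [LieRing 𝔫] [LieAlgebra ℝ 𝔫] [TwoStepLie 𝔫]

/-- The Baker-Campbell-Hausdorff law `exp v * exp w = exp (v + w + [v, w] / 2)`. -/
instance : Mul (NilGroup 𝔫) :=
  ⟨fun g h => exp (g.log + h.log + (1 / 2 : ℝ) • ⁅g.log, h.log⁆)⟩

instance : One (NilGroup 𝔫) := ⟨exp 0⟩

instance : Inv (NilGroup 𝔫) := ⟨fun g => exp (-g.log)⟩

theorem log_mul (g h : NilGroup 𝔫) :
    (g * h).log = g.log + h.log + (1 / 2 : ℝ) • ⁅g.log, h.log⁆ := rfl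

theorem lie_lie_right (x y z : 𝔫) : ⁅x, ⁅y, z⁆⁆ = 0 := by
  rw [← lie_skew, TwoStepLie.lie_lie_eq_zero, neg_zero]

instance : Group (NilGroup 𝔫) where
  mul_assoc a b c := by
    ext
    simp only [log_mul, lie_add, add_lie, lie_smul, smul_lie, TwoStepLie.lie_lie_eq_zero,
      lie_lie_right, smul_zero, add_zero, smul_add]
    abel
  one_mul a := by
    ext
    change (0 : 𝔫) + a.log + (1 / 2 : ℝ) • ⁅(0 : 𝔫), a.log⁆ = a.log
    simp
  mul_one a := by
    ext
    change a.log + (0 : 𝔫) + (1 / 2 : ℝ) • ⁅a.log, (0 : 𝔫)⁆ = a.log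
    simp
  inv_mul_cancel a := by
    ext
    change -a.log + a.log + (1 / 2 : ℝ) • ⁅-a.log, a.log⁆ = 0
    simp

/-- The topology of `N` is that of the finite-dimensional real vector space `𝔫`. -/
instance : TopologicalSpace (NilGroup 𝔫) := (moduleTopology ℝ 𝔫).induced log

instance : MeasurableSpace (NilGroup 𝔫) := borel _

instance : BorelSpace (NilGroup 𝔫) := ⟨rfl⟩

end NilGroup

/-- Coordinates `(z, y, x)` with `z ∈ ℝ^m`, `y, x ∈ ℝ^d`. -/
abbrev Coords (m d : ℕ) : Type := (Fin m → ℝ) × (Fin d → ℝ) × (Fin d → ℝ)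

/-- A basis `Z_1, …, Z_m, Y_1, …, Y_d, X_1, …, X_d` of the Lie algebra `𝔫` such that the `Z_k` span
the center, the `Y_j` commute with each other, the `X_j` commute with each other, and some linear
functional on `𝔫` has the center as its radical (so that `exp 𝔫` is square integrable modulo
its center). -/
structure AdaptedBasis (𝔫 : Type*) [LieRing 𝔫] [LieAlgebra ℝ 𝔫] (m d : ℕ) where
  basis : Module.Basis (Fin m ⊕ (Fin d ⊕ Fin d)) ℝ 𝔫
  span_Z : Submodule.span ℝ (Set.range fun k => basis (Sum.inl k))
    = (LieAlgebra.center ℝ 𝔫).toSubmodule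
  lie_Y : ∀ i j, ⁅basis (Sum.inr (Sum.inl i)), basis (Sum.inr (Sum.inl j))⁆ = 0
  lie_X : ∀ i j, ⁅basis (Sum.inr (Sum.inr i)), basis (Sum.inr (Sum.inr j))⁆ = 0
  exists_flat : ∃ f : Module.Dual ℝ 𝔫,
    ∀ v : 𝔫, (∀ w : 𝔫, f ⁅v, w⁆ = 0) ↔ v ∈ LieAlgebra.center ℝ 𝔫

namespace AdaptedBasis

variable {𝔫 : Type*} [LieRing 𝔫] [LieAlgebra ℝ 𝔫] {m d : ℕ} (e : AdaptedBasis 𝔫 m d)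

def Z (k : Fin m) : 𝔫 := e.basis (Sum.inl k)

def Y (j : Fin d) : 𝔫 := e.basis (Sum.inr (Sum.inl j))

def X (j : Fin d) : 𝔫 := e.basis (Sum.inr (Sum.inr j))

/-! ### The coordinates `(z, y, x) ↦ exp (∑ z_k Z_k) exp (∑ y_j Y_j) exp (∑ x_j X_j)` on `N` -/

/-- `∑ z_k Z_k` -/
def zVec (z : Fin m → ℝ) : 𝔫 := ∑ k, z k • e.Z k

/-- `∑ y_j Y_j` -/
def yVec (y : Fin d → ℝ) : 𝔫 := ∑ j, y j • e.Y j

/-- `∑ x_j X_j` -/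
def xVec (x : Fin d → ℝ) : 𝔫 := ∑ j, x j • e.X j

/-- The element `exp (∑ z_k Z_k) exp (∑ y_j Y_j) exp (∑ x_j X_j)` of `N`. -/
def ofCoords (p : Coords m d) : NilGroup 𝔫 :=
  NilGroup.exp (e.zVec p.1) * NilGroup.exp (e.yVec p.2.1) * NilGroup.exp (e.xVec p.2.2)

def zRepr (v : 𝔫) (k : Fin m) : ℝ := e.basis.repr v (Sum.inl k)

def yRepr (v : 𝔫) (j : Fin d) : ℝ := e.basis.repr v (Sum.inr (Sum.inl j))

def xRepr (v : 𝔫) (j : Fin d) : ℝ := e.basis.repr v (Sum.inr (Sum.inr j))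

/-- The coordinates of an element of `N`: the inverse of `ofCoords`. -/
def toCoords (n : NilGroup 𝔫) : Coords m d :=
  (e.zRepr (n.log - (1 / 2 : ℝ) • ⁅e.yVec (e.yRepr n.log), e.xVec (e.xRepr n.log)⁆),
    e.yRepr n.log, e.xRepr n.log)

theorem zRepr_add (v w : 𝔫) : e.zRepr (v + w) = e.zRepr v + e.zRepr w := by
  ext; simp [zRepr]
theorem yRepr_add (v w : 𝔫) : e.yRepr (v + w) = e.yRepr v + e.yRepr w := by
  ext; simp [yRepr]
theorem xRepr_add (v w : 𝔫) : e.xRepr (v + w) = e.xRepr v + e.xRepr w := by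
  ext; simp [xRepr]
theorem zVec_add (z z' : Fin m → ℝ) : e.zVec (z + z') = e.zVec z + e.zVec z' := by
  simp [zVec, add_smul, Finset.sum_add_distrib]
theorem yVec_add (z z' : Fin d → ℝ) : e.yVec (z + z') = e.yVec z + e.yVec z' := by
  simp [yVec, add_smul, Finset.sum_add_distrib]
theorem xVec_add (z z' : Fin d → ℝ) : e.xVec (z + z') = e.xVec z + e.xVec z' := by
  simp [xVec, add_smul, Finset.sum_add_distrib]

theorem decomp (v : 𝔫) : e.zVec (e.zRepr v) + e.yVec (e.yRepr v) + e.xVec (e.xRepr v) = v := by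
  have h := e.basis.sum_repr v
  rw [Fintype.sum_sum_type, Fintype.sum_sum_type, ← add_assoc] at h
  exact h

theorem repr_zVec (z : Fin m → ℝ) :
    e.zRepr (e.zVec z) = z ∧ e.yRepr (e.zVec z) = 0 ∧ e.xRepr (e.zVec z) = 0 := by
  refine ⟨?_, ?_, ?_⟩ <;> ext i <;>
    simp [zVec, Z, zRepr, yRepr, xRepr, Finsupp.single_apply]

theorem repr_yVec (y : Fin d → ℝ) :
    e.zRepr (e.yVec y) = 0 ∧ e.yRepr (e.yVec y) = y ∧ e.xRepr (e.yVec y) = 0 := by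
  refine ⟨?_, ?_, ?_⟩ <;> ext i <;>
    simp [yVec, Y, zRepr, yRepr, xRepr, Finsupp.single_apply]

theorem repr_xVec (x : Fin d → ℝ) :
    e.zRepr (e.xVec x) = 0 ∧ e.yRepr (e.xVec x) = 0 ∧ e.xRepr (e.xVec x) = x := by
  refine ⟨?_, ?_, ?_⟩ <;> ext i <;>
    simp [xVec, X, zRepr, yRepr, xRepr, Finsupp.single_apply]

theorem zVec_zRepr {v : 𝔫} (hv : v ∈ LieAlgebra.center ℝ 𝔫) : e.zVec (e.zRepr v) = v := by
  have h : v ∈ Submodule.span ℝ (Set.range fun k => e.basis (Sum.inl k)) := by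
    rw [e.span_Z]; exact hv
  obtain ⟨c, rfl⟩ := (Submodule.mem_span_range_iff_exists_fun ℝ).1 h
  change e.zVec (e.zRepr (e.zVec c)) = e.zVec c
  rw [(e.repr_zVec c).1]

theorem zVec_mem_center (z : Fin m → ℝ) : e.zVec z ∈ LieAlgebra.center ℝ 𝔫 := by
  have h : e.zVec z ∈ (LieAlgebra.center ℝ 𝔫).toSubmodule := by
    rw [← e.span_Z]
    exact (Submodule.mem_span_range_iff_exists_fun ℝ).2 ⟨z, rfl⟩
  exact h

theorem lie_zVec (v : 𝔫) (z : Fin m → ℝ) : ⁅v, e.zVec z⁆ = 0 :=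
  (LieModule.mem_maxTrivSubmodule ℝ 𝔫 𝔫 _).1 (e.zVec_mem_center z) v

theorem zVec_lie (v : 𝔫) (z : Fin m → ℝ) : ⁅e.zVec z, v⁆ = 0 := by
  rw [← lie_skew, lie_zVec, neg_zero]

theorem lie_yVec (y y' : Fin d → ℝ) : ⁅e.yVec y, e.yVec y'⁆ = 0 := by
  simp [yVec, Y, sum_lie, lie_sum, e.lie_Y]

theorem lie_xVec (y y' : Fin d → ℝ) : ⁅e.xVec y, e.xVec y'⁆ = 0 := by
  simp [xVec, X, sum_lie, lie_sum, e.lie_X]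

variable [TwoStepLie 𝔫]

theorem lie_mem_center (v w : 𝔫) : ⁅v, w⁆ ∈ LieAlgebra.center ℝ 𝔫 :=
  (LieModule.mem_maxTrivSubmodule ℝ 𝔫 𝔫 _).2 fun x => NilGroup.lie_lie_right x v w

theorem log_ofCoords (p : Coords m d) :
    (e.ofCoords p).log = e.zVec p.1 + e.yVec p.2.1 + e.xVec p.2.2
      + (1 / 2 : ℝ) • ⁅e.yVec p.2.1, e.xVec p.2.2⁆ := by
  simp [ofCoords, NilGroup.log_mul, zVec_lie]

theorem toCoords_ofCoords (p : Coords m d) : e.toCoords (e.ofCoords p) = p := by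
  obtain ⟨z, y, x⟩ := p
  have hc := e.zVec_zRepr (Submodule.smul_mem (LieAlgebra.center ℝ 𝔫).toSubmodule (1 / 2 : ℝ)
    (lie_mem_center (e.yVec y) (e.xVec x)))
  have hl := e.log_ofCoords (z, y, x)
  simp only at hl
  have hy : e.yRepr (e.ofCoords (z, y, x)).log = y := by
    rw [hl, ← hc]
    simp [yRepr_add, (e.repr_zVec _).2.1, (e.repr_yVec _).2.1, (e.repr_xVec _).2.1]
  have hx : e.xRepr (e.ofCoords (z, y, x)).log = x := by
    rw [hl, ← hc]
    simp [xRepr_add, (e.repr_zVec _).2.2, (e.repr_yVec _).2.2, (e.repr_xVec _).2.2]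
  simp only [toCoords, hy, hx]
  rw [hl, add_sub_cancel_right]
  simp [zRepr_add, (e.repr_zVec _).1, (e.repr_yVec _).1, (e.repr_xVec _).1]

theorem ofCoords_toCoords (n : NilGroup 𝔫) : e.ofCoords (e.toCoords n) = n := by
  ext
  rw [log_ofCoords]
  have hc := e.zVec_zRepr (Submodule.smul_mem (LieAlgebra.center ℝ 𝔫).toSubmodule (-(1 / 2) : ℝ)
    (lie_mem_center (e.yVec (e.yRepr n.log)) (e.xVec (e.xRepr n.log))))
  have h2 := e.decomp n.log
  simp only [toCoords, sub_eq_add_neg, ← neg_smul, zRepr_add, zVec_add, hc]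
  conv_rhs => rw [← h2]
  module

theorem continuous_ofCoords : Continuous e.ofCoords := by
  letI : TopologicalSpace 𝔫 := moduleTopology ℝ 𝔫
  haveI : IsModuleTopology ℝ 𝔫 := ⟨rfl⟩
  haveI : ContinuousAdd 𝔫 := IsModuleTopology.toContinuousAdd ℝ 𝔫
  haveI : ContinuousSMul ℝ 𝔫 := inferInstance
  refine continuous_induced_rng.2 ?_
  have : (NilGroup.log ∘ e.ofCoords) = fun p : Coords m d =>
      e.zVec p.1 + e.yVec p.2.1 + e.xVec p.2.2
        + (1 / 2 : ℝ) • ⁅e.yVec p.2.1, e.xVec p.2.2⁆ := by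
    funext p; exact e.log_ofCoords p
  rw [this]
  simp only [zVec, yVec, xVec, sum_lie, lie_sum, smul_lie, lie_smul]
  fun_prop

theorem continuous_toCoords : Continuous e.toCoords := by
  letI : TopologicalSpace 𝔫 := moduleTopology ℝ 𝔫
  haveI : IsModuleTopology ℝ 𝔫 := ⟨rfl⟩
  haveI : ContinuousAdd 𝔫 := IsModuleTopology.toContinuousAdd ℝ 𝔫
  haveI : IsTopologicalAddGroup 𝔫 := IsModuleTopology.topologicalAddGroup ℝ 𝔫
  haveI : ContinuousSMul ℝ 𝔫 := inferInstance
  have hlog : Continuous (NilGroup.log : NilGroup 𝔫 → 𝔫) := continuous_induced_dom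
  have hrep : ∀ i, Continuous fun v : 𝔫 => e.basis.repr v i := fun i =>
    IsModuleTopology.continuous_of_linearMap (e.basis.coord i)
  have hy : Continuous fun n : NilGroup 𝔫 => e.yRepr n.log :=
    continuous_pi fun i => (hrep _).comp hlog
  have hx : Continuous fun n : NilGroup 𝔫 => e.xRepr n.log :=
    continuous_pi fun i => (hrep _).comp hlog
  refine Continuous.prodMk (continuous_pi fun i => (hrep _).comp ?_) (hy.prodMk hx)
  refine hlog.sub ?_
  simp only [yVec, xVec, sum_lie, lie_sum, smul_lie, lie_smul]
  fun_prop

/-- The global chart `(z, y, x) ↦ exp (∑ z_k Z_k) exp (∑ y_j Y_j) exp (∑ x_j X_j)` of `N`. -/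
def chart : Coords m d ≃ₜ NilGroup 𝔫 where
  toFun := e.ofCoords
  invFun := e.toCoords
  left_inv := e.toCoords_ofCoords
  right_inv := e.ofCoords_toCoords
  continuous_toFun := e.continuous_ofCoords
  continuous_invFun := e.continuous_toCoords

/-- The Haar measure of `N`: Lebesgue measure `dz dy dx` in the coordinates `(z, y, x)`. -/
def haar : Measure (NilGroup 𝔫) := (volume : Measure (Coords m d)).map e.ofCoords

theorem measurePreserving_ofCoords : MeasurePreserving e.ofCoords volume e.haar :=
  ⟨e.continuous_ofCoords.measurable, rfl⟩

theorem measurePreserving_toCoords : MeasurePreserving e.toCoords e.haar volume :=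
  (MeasurePreserving.symm e.chart.toMeasurableEquiv e.measurePreserving_ofCoords :)

/-- The group law in coordinates. -/
theorem ofCoords_mul (g p : Coords m d) : e.ofCoords g * e.ofCoords p =
    e.ofCoords (p.1 + (g.1 + e.zRepr ⁅e.xVec g.2.2, e.yVec p.2.1⁆),
      p.2.1 + g.2.1, p.2.2 + g.2.2) := by
  ext
  have hc := e.zVec_zRepr (lie_mem_center (e.xVec g.2.2) (e.yVec p.2.1))
  rw [NilGroup.log_mul]
  simp only [log_ofCoords, zVec_add, yVec_add, xVec_add, hc, lie_add, add_lie, lie_smul, smul_lie,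
    TwoStepLie.lie_lie_eq_zero, NilGroup.lie_lie_right, lie_zVec, zVec_lie, lie_yVec, lie_xVec]
  rw [← lie_skew (e.xVec g.2.2) (e.yVec p.2.1)]
  module

theorem measurePreserving_mul_left (g : NilGroup 𝔫) :
    MeasurePreserving (fun n => g * n) e.haar e.haar := by
  set c := e.toCoords g with hc
  have hshift : MeasurePreserving (fun p : Coords m d =>
      ((p.1 + (c.1 + e.zRepr ⁅e.xVec c.2.2, e.yVec p.2.1⁆), p.2.1 + c.2.1, p.2.2 + c.2.2) :
        Coords m d)) volume volume := by
    have hb : MeasurePreserving (fun r : (Fin d → ℝ) × (Fin d → ℝ) => (r.1 + c.2.1, r.2 + c.2.2))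
        volume volume :=
      (measurePreserving_add_right volume c.2.1).prod (measurePreserving_add_right volume c.2.2)
    have hm : Measurable fun y : Fin d → ℝ => e.zRepr ⁅e.xVec c.2.2, e.yVec y⁆ := by
      refine measurable_pi_lambda _ fun k => ?_
      simp only [zRepr, yVec, lie_sum, lie_smul, map_sum, map_smul, Finsupp.coe_finsetSum,
        Finset.sum_apply, Finsupp.smul_apply, smul_eq_mul]
      fun_prop
    have h := MeasurePreserving.skew_product (μa := (volume : Measure ((Fin d → ℝ) × (Fin d → ℝ))))
      (μb := volume) (μc := (volume : Measure (Fin m → ℝ))) (μd := volume) hb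
      (g := fun r z => z + (c.1 + e.zRepr ⁅e.xVec c.2.2, e.yVec r.1⁆)) (by
        simp only [Function.uncurry_def]
        have := hm.comp (measurable_fst.comp measurable_fst :
          Measurable fun p : ((Fin d → ℝ) × (Fin d → ℝ)) × (Fin m → ℝ) => p.1.1)
        fun_prop)
      (Filter.Eventually.of_forall fun r => (measurePreserving_add_right volume _).map_eq)
    exact (Measure.measurePreserving_swap.comp h).comp Measure.measurePreserving_swap
  have h := (e.measurePreserving_ofCoords.comp hshift).comp e.measurePreserving_toCoords
  convert h using 1
  funext n
  have := e.ofCoords_mul c (e.toCoords n)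
  rw [e.ofCoords_toCoords, hc, e.ofCoords_toCoords] at this
  exact this

/-! ### The left regular representation and the quasi-lattices -/

/-- `L²(N)` -/
abbrev L2N : Type _ := Lp ℂ 2 e.haar

/-- The left regular representation `(L(g) f)(n) = f(g⁻¹ n)` on `L²(N)`. -/
def leftRegular (g : NilGroup 𝔫) : e.L2N →ₗᵢ[ℂ] e.L2N :=
  Lp.compMeasurePreservingₗᵢ ℂ (fun n => g⁻¹ * n) (e.measurePreserving_mul_left g⁻¹)

/-- The quasi-lattice `Γ_{a,q,b}` of all
`exp (∑ (m_j / a_j) Z_j) exp (∑ (k_j / q_j) Y_j) exp (∑ (n_j / b_j) X_j)`, `m_j, k_j, n_j ∈ ℤ`. -/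
def quasiLattice (a : Fin m → ℝ) (q b : Fin d → ℝ) : Set (NilGroup 𝔫) :=
  {g | ∃ (i : Fin m → ℤ) (k n : Fin d → ℤ),
    g = NilGroup.exp (e.zVec fun j => i j / a j) * NilGroup.exp (e.yVec fun j => k j / q j) *
      NilGroup.exp (e.xVec fun j => n j / b j)}

/-! ### Linear functionals on the center and the Plancherel measure -/

/-- The linear functional on `𝔫` with `Z_k ↦ ℓ_k`, `Y_j ↦ 0`, `X_j ↦ 0`; this identifies `ℝ^m` with
the dual of the center. -/
def functional (ℓ : Fin m → ℝ) : Module.Dual ℝ 𝔫 := ∑ k, ℓ k • e.basis.coord (Sum.inl k)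

/-- `V(ℓ) = (ℓ[E_i, E_j])_{i,j}`, where `E` runs through `Y_1, …, Y_d, X_1, …, X_d`. -/
def matrixV (ℓ : Fin m → ℝ) : Matrix (Fin d ⊕ Fin d) (Fin d ⊕ Fin d) ℝ :=
  Matrix.of fun i j => e.functional ℓ ⁅e.basis (Sum.inr i), e.basis (Sum.inr j)⁆

/-- `B(ℓ) = (-ℓ[X_i, Y_j])_{i,j}` -/
def matrixB (ℓ : Fin m → ℝ) : Matrix (Fin d) (Fin d) ℝ :=
  Matrix.of fun i j => -e.functional ℓ ⁅e.X i, e.Y j⁆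

/-- The cross-section `Σ` of the generic coadjoint orbits, inside the dual `ℝ^m` of the center. -/
def crossSection : Set (Fin m → ℝ) := {ℓ | (e.matrixV ℓ).det ≠ 0}

/-- The Plancherel measure `dμ(ℓ) = |det B(ℓ)| dℓ` on `Σ`. -/
def plancherelMeasure : Measure (Fin m → ℝ) :=
  (volume.restrict e.crossSection).withDensity fun ℓ => ENNReal.ofReal |(e.matrixB ℓ).det|

/-! ### The irreducible representations `π_ℓ` on `L²(ℝ^d)` -/

/-- `L²(ℝ^d)` -/
abbrev L2R (d : ℕ) : Type := Lp ℂ 2 (volume : Measure (Fin d → ℝ))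

/-- `L²(ℝ^d × ℝ^d)`-kernels live on this space. -/
abbrev Plane (d : ℕ) : Type := (Fin d → ℝ) × (Fin d → ℝ)

theorem norm_phase (r : ℝ) : ‖Complex.exp (2 * Real.pi * Complex.I * r)‖ = 1 := by
  rw [show 2 * (Real.pi : ℂ) * Complex.I * r = ((2 * Real.pi * r : ℝ) : ℂ) * Complex.I by
    push_cast; ring]
  exact Complex.norm_exp_ofReal_mul_I _

theorem memLp_phase_mul {θ : (Fin d → ℝ) → ℝ} (hθ : Measurable θ) (F : L2R d) :
    MemLp (fun t => Complex.exp (2 * Real.pi * Complex.I * θ t) * F t) 2 volume := by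
  refine (Lp.memLp F).of_le (AEStronglyMeasurable.mul ?_ (Lp.aestronglyMeasurable F))
    (Filter.Eventually.of_forall fun t => ?_)
  · have : Measurable fun t => Complex.exp (2 * Real.pi * Complex.I * θ t) := by fun_prop
    exact this.aestronglyMeasurable
  · rw [norm_mul, norm_phase, one_mul]

/-- Multiplication by `t ↦ exp (2 π i θ(t))` on `L²(ℝ^d)`. -/
def modulation (θ : (Fin d → ℝ) → ℝ) (hθ : Measurable θ) : L2R d →ₗᵢ[ℂ] L2R d where
  toFun F := (memLp_phase_mul hθ F).toLp _
  map_add' F G := by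
    rw [← MemLp.toLp_add]
    refine MemLp.toLp_congr _ _ ?_
    filter_upwards [Lp.coeFn_add F G] with t ht
    rw [ht, Pi.add_apply, Pi.add_apply, mul_add]
  map_smul' c F := by
    rw [RingHom.id_apply, ← MemLp.toLp_const_smul]
    refine MemLp.toLp_congr _ _ ?_
    filter_upwards [Lp.coeFn_smul c F] with t ht
    rw [ht, Pi.smul_apply, Pi.smul_apply, smul_eq_mul, smul_eq_mul]
    ring
  norm_map' F := by
    change ‖(memLp_phase_mul hθ F).toLp _‖ = ‖F‖
    refine le_antisymm (Lp.norm_le_norm_of_ae_le ?_) (Lp.norm_le_norm_of_ae_le ?_) <;>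
    · filter_upwards [MemLp.coeFn_toLp (memLp_phase_mul hθ F)] with t ht
      rw [ht, norm_mul, norm_phase, one_mul]

/-- Translation `F ↦ F(· - x)` on `L²(ℝ^d)`. -/
def translation (x : Fin d → ℝ) : L2R d →ₗᵢ[ℂ] L2R d :=
  Lp.compMeasurePreservingₗᵢ ℂ (fun t => t - x) (measurePreserving_sub_right volume x)

/-- The phase `⟨ℓ, z⟩ + ⟨t, B(ℓ) y⟩` by which `π_ℓ` modulates at `t`. -/
def phase (ℓ : Fin m → ℝ) (p : Coords m d) (t : Fin d → ℝ) : ℝ :=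
  ℓ ⬝ᵥ p.1 + t ⬝ᵥ (e.matrixB ℓ *ᵥ p.2.1)

theorem measurable_phase (ℓ : Fin m → ℝ) (p : Coords m d) : Measurable (e.phase ℓ p) := by
  unfold phase dotProduct
  fun_prop

/-- The representation of `N` induced from the character `exp (2 π i ℓ)` of the subgroup
`P = exp (span {Z_k, Y_j})`, realized on `L²(ℝ^d)`: if `n` has the coordinates `(z, y, x)`, then
`(π_ℓ(n) F)(t) = exp (2 π i (⟨ℓ, z⟩ + ⟨t, B(ℓ) y⟩)) F(t - x)`. -/
def rep (ℓ : Fin m → ℝ) (n : NilGroup 𝔫) : L2R d →ₗᵢ[ℂ] L2R d :=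
  (modulation (e.phase ℓ (e.toCoords n)) (e.measurable_phase ℓ (e.toCoords n))).comp
    (translation (e.toCoords n).2.2)

theorem coeFn_rep (ℓ : Fin m → ℝ) (n : NilGroup 𝔫) (F : L2R d) :
    e.rep ℓ n F =ᵐ[volume] fun t =>
      Complex.exp (2 * Real.pi * Complex.I * e.phase ℓ (e.toCoords n) t) *
        F (t - (e.toCoords n).2.2) := by
  have h1 := MemLp.coeFn_toLp (memLp_phase_mul (e.measurable_phase ℓ (e.toCoords n))
    (translation (e.toCoords n).2.2 F))
  have h2 : translation (e.toCoords n).2.2 F =ᵐ[volume] fun t => F (t - (e.toCoords n).2.2) :=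
    Lp.coeFn_compMeasurePreserving F (measurePreserving_sub_right volume _)
  filter_upwards [h1, h2] with t ht1 ht2
  rw [← ht2]
  exact ht1

/-! ### The Plancherel transform -/

/-- The matrix coefficient `⟨π_ℓ(n) h, g⟩` (the inner product of Mathlib is conjugate linear in its
first argument). -/
def coeff (ℓ : Fin m → ℝ) (g h : L2R d) (n : NilGroup 𝔫) : ℂ := inner ℂ g (e.rep ℓ n h)

theorem aestronglyMeasurable_coeff (ℓ : Fin m → ℝ) (g h : L2R d) :
    AEStronglyMeasurable (e.coeff ℓ g h) e.haar := by
  have h0 : e.coeff ℓ g h = (fun p : Coords m d => ∫ t, (starRingEnd ℂ) (g t) *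
      (Complex.exp (2 * Real.pi * Complex.I * e.phase ℓ p t) * h (t - p.2.2))) ∘ e.toCoords := by
    funext n
    rw [coeff, L2.inner_def]
    refine integral_congr_ae ?_
    filter_upwards [e.coeFn_rep ℓ n h] with t ht
    simp only [RCLike.inner_apply, ht]
    ring
  have h1 : StronglyMeasurable fun p : Coords m d => ∫ t, (starRingEnd ℂ) (g t) *
      (Complex.exp (2 * Real.pi * Complex.I * e.phase ℓ p t) * h (t - p.2.2)) := by
    refine StronglyMeasurable.integral_prod_right (f := fun (p : Coords m d) (t : Fin d → ℝ) =>
      (starRingEnd ℂ) (g t) *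
      (Complex.exp (2 * Real.pi * Complex.I * e.phase ℓ p t) * h (t - p.2.2))) ?_
    refine Measurable.stronglyMeasurable ?_
    have hg : Measurable g := (Lp.stronglyMeasurable g).measurable
    have hh : Measurable h := (Lp.stronglyMeasurable h).measurable
    have hp : Measurable fun x : Coords m d × (Fin d → ℝ) => e.phase ℓ x.1 x.2 := by
      unfold phase dotProduct mulVec dotProduct
      fun_prop
    simp only [Function.uncurry_def]
    have hh' := hh.comp (by fun_prop :
      Measurable fun x : Coords m d × (Fin d → ℝ) => x.2 - x.1.2.2)
    have hg' := hg.comp (measurable_snd : Measurable fun x : Coords m d × (Fin d → ℝ) => x.2)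
    refine Measurable.mul ?_ (Measurable.mul (by fun_prop) hh')
    exact Complex.continuous_conj.measurable.comp hg'
  rw [h0]
  exact (h1.comp_measurable e.continuous_toCoords.measurable).aestronglyMeasurable

theorem integrable_mul_coeff (ℓ : Fin m → ℝ) (g h : L2R d) {f : NilGroup 𝔫 → ℂ}
    (hf : Integrable f e.haar) : Integrable (fun n => f n * e.coeff ℓ g h n) e.haar :=
  hf.mul_bdd (c := ‖g‖ * ‖h‖) (e.aestronglyMeasurable_coeff ℓ g h)
    (Filter.Eventually.of_forall fun n =>
      (norm_inner_le_norm g (e.rep ℓ n h)).trans (by rw [LinearIsometry.norm_map]))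

/-- The sesquilinear form `⟨T h, g⟩` of the Hilbert-Schmidt operator
`(T h)(t) = ∫ k(t, s) h(s) ds` on `L²(ℝ^d)`. -/
def kernelForm (k : Plane d → ℂ) (g h : L2R d) : ℂ :=
  ∫ p : Plane d, k p * ((starRingEnd ℂ) (g p.1) * h p.2)

theorem integrable_kernelForm {k : Plane d → ℂ} (hk : MemLp k 2 volume) (g h : L2R d) :
    Integrable (fun p : Plane d => k p * ((starRingEnd ℂ) (g p.1) * h p.2)) volume := by
  refine MemLp.integrable_mul (p := 2) (q := 2) hk ?_
  have hg : MemLp (fun p : Plane d => (starRingEnd ℂ) (g p.1) * h p.2) 2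
      ((volume : Measure (Fin d → ℝ)).prod volume) := by
    have hm : AEStronglyMeasurable (fun p : Plane d => (starRingEnd ℂ) (g p.1) * h p.2)
        ((volume : Measure (Fin d → ℝ)).prod volume) :=
      (Complex.continuous_conj.comp_aestronglyMeasurable
        (Lp.aestronglyMeasurable g).comp_fst).mul (Lp.aestronglyMeasurable h).comp_snd
    rw [memLp_two_iff_integrable_sq_norm hm]
    have h1 := (memLp_two_iff_integrable_sq_norm (Lp.aestronglyMeasurable g)).1 (Lp.memLp g)
    have h2 := (memLp_two_iff_integrable_sq_norm (Lp.aestronglyMeasurable h)).1 (Lp.memLp h)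
    refine (h1.mul_prod h2).congr (Filter.Eventually.of_forall fun p => ?_)
    simp [mul_pow]
  exact hg

/-- `k` is the integral kernel of the Hilbert-Schmidt operator
`F(f)(ℓ) = ∫_N f(n) π_ℓ(n) dn` on `L²(ℝ^d)`. The operator-valued integral is a weak integral. -/
def IsFourierKernel (f : NilGroup 𝔫 → ℂ) (ℓ : Fin m → ℝ) (k : Plane d → ℂ) : Prop :=
  MemLp k 2 volume ∧
    ∀ g h : L2R d, kernelForm k g h = ∫ n, f n * e.coeff ℓ g h n ∂e.haar

/-- The direct integral `∫^⊕_Σ L²(ℝ^d) ⊗ L²(ℝ^d) dμ(ℓ)`, realized as the space of all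
square-integrable families `K(ℓ, ·, ·)` of integral kernels of Hilbert-Schmidt operators, with
respect to `dμ(ℓ) dt ds`. -/
abbrev L2Sigma : Type := Lp ℂ 2 (e.plancherelMeasure.prod (volume : Measure (Plane d)))

/-- The graph of the Fourier transform on `L¹(N) ∩ L²(N)`. -/
def fourierGraph : Submodule ℂ (e.L2N × e.L2Sigma) where
  carrier := {fK | Integrable fK.1 e.haar ∧
    ∀ᵐ ℓ ∂e.plancherelMeasure, e.IsFourierKernel fK.1 ℓ fun p => fK.2 (ℓ, p)}
  zero_mem' := by
    refine ⟨(integrable_zero _ _ _).congr (Lp.coeFn_zero ℂ 2 e.haar).symm, ?_⟩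
    filter_upwards [Measure.ae_ae_of_ae_prod
      (Lp.coeFn_zero ℂ 2 (e.plancherelMeasure.prod (volume : Measure (Plane d))))] with ℓ hℓ
    refine ⟨(MemLp.zero (ε := ℂ)).ae_eq (Filter.EventuallyEq.symm hℓ), fun g h => ?_⟩
    have h1 : kernelForm (fun p => (0 : e.L2Sigma) (ℓ, p)) g h = 0 := by
      refine integral_eq_zero_of_ae ?_
      filter_upwards [hℓ] with p hp
      simp only [hp, Pi.zero_apply, zero_mul]
    have h2 : ∫ n, (0 : e.L2N) n * e.coeff ℓ g h n ∂e.haar = 0 := by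
      refine integral_eq_zero_of_ae ?_
      filter_upwards [Lp.coeFn_zero ℂ 2 e.haar] with n hn
      simp only [hn, Pi.zero_apply, zero_mul]
    exact h1.trans h2.symm
  add_mem' := by
    rintro ⟨f, K⟩ ⟨f', K'⟩ ⟨hf, hK⟩ ⟨hf', hK'⟩
    refine ⟨(hf.add hf').congr (Lp.coeFn_add f f').symm, ?_⟩
    filter_upwards [hK, hK', Measure.ae_ae_of_ae_prod (Lp.coeFn_add K K')] with ℓ h1 h2 h3
    refine ⟨(h1.1.add h2.1).ae_eq (Filter.EventuallyEq.symm h3), fun g h => ?_⟩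
    have e1 : kernelForm (fun p => (K + K') (ℓ, p)) g h =
        kernelForm (fun p => K (ℓ, p)) g h + kernelForm (fun p => K' (ℓ, p)) g h := by
      rw [kernelForm, kernelForm, kernelForm,
        ← integral_add (integrable_kernelForm h1.1 g h) (integrable_kernelForm h2.1 g h)]
      refine integral_congr_ae ?_
      filter_upwards [h3] with p hp
      simp only [hp, Pi.add_apply, add_mul]
    have e2 : ∫ n, (f + f') n * e.coeff ℓ g h n ∂e.haar =
        ∫ n, f n * e.coeff ℓ g h n ∂e.haar + ∫ n, f' n * e.coeff ℓ g h n ∂e.haar := by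
      rw [← integral_add (e.integrable_mul_coeff ℓ g h hf) (e.integrable_mul_coeff ℓ g h hf')]
      refine integral_congr_ae ?_
      filter_upwards [Lp.coeFn_add f f'] with n hn
      simp only [hn, Pi.add_apply, add_mul]
    exact e1.trans ((congrArg₂ (· + ·) (h1.2 g h) (h2.2 g h)).trans e2.symm)
  smul_mem' := by
    rintro c ⟨f, K⟩ ⟨hf, hK⟩
    refine ⟨(hf.smul c).congr (Lp.coeFn_smul c f).symm, ?_⟩
    filter_upwards [hK, Measure.ae_ae_of_ae_prod (Lp.coeFn_smul c K)] with ℓ h1 h3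
    refine ⟨(h1.1.const_smul c).ae_eq (Filter.EventuallyEq.symm h3), fun g h => ?_⟩
    have e1 : kernelForm (fun p => (c • K) (ℓ, p)) g h =
        c * kernelForm (fun p => K (ℓ, p)) g h := by
      rw [kernelForm, kernelForm, ← integral_const_mul]
      refine integral_congr_ae ?_
      filter_upwards [h3] with p hp
      simp only [hp, Pi.smul_apply, smul_eq_mul, mul_assoc]
    have e2 : ∫ n, (c • f) n * e.coeff ℓ g h n ∂e.haar =
        c * ∫ n, f n * e.coeff ℓ g h n ∂e.haar := by
      rw [← integral_const_mul]
      refine integral_congr_ae ?_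
      filter_upwards [Lp.coeFn_smul c f] with n hn
      simp only [hn, Pi.smul_apply, smul_eq_mul, mul_assoc]
    exact e1.trans ((congrArg (c * ·) (h1.2 g h)).trans e2.symm)

/-- The graph of the Plancherel transform `P`, the extension of the Fourier transform from
`L¹(N) ∩ L²(N)` to `L²(N)` by continuity: `K = P f` if and only if some `f_j ∈ L¹(N) ∩ L²(N)`
converge to `f` in `L²(N)` while their Fourier transforms converge to `K`. -/
def plancherelGraph : Submodule ℂ (e.L2N × e.L2Sigma) := e.fourierGraph.topologicalClosure

/-! ### Multiplicity-free band-limited spaces and Parseval frames -/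

/-- The subspace `F = ∫^⊕_I L²(ℝ^d) ⊗ u dμ(ℓ)` of the direct integral. The tensor `v ⊗ u` is the
operator `h ↦ ⟨h, u⟩ v`, whose kernel is `v(t) * conj (u(s))`. -/
def rankOneField (I : Set (Fin m → ℝ)) (u : L2R d) : Submodule ℂ e.L2Sigma where
  carrier := {K | ∀ᵐ ℓ ∂e.plancherelMeasure,
    (ℓ ∈ I → ∃ v : L2R d, ∀ᵐ p : Plane d, K (ℓ, p) = v p.1 * (starRingEnd ℂ) (u p.2)) ∧
    (ℓ ∉ I → ∀ᵐ p : Plane d, K (ℓ, p) = 0)}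
  zero_mem' := by
    filter_upwards [Measure.ae_ae_of_ae_prod
      (Lp.coeFn_zero ℂ 2 (e.plancherelMeasure.prod (volume : Measure (Plane d))))] with ℓ hℓ
    refine ⟨fun _ => ⟨0, ?_⟩, fun _ => hℓ⟩
    have h0 := (Measure.quasiMeasurePreserving_fst (μ := (volume : Measure (Fin d → ℝ)))
      (ν := (volume : Measure (Fin d → ℝ)))).ae (Lp.coeFn_zero ℂ 2 volume)
    filter_upwards [hℓ, h0] with p hp hp0
    rw [hp, hp0]
    simp
  add_mem' := by
    intro K K' hK hK'
    filter_upwards [hK, hK', Measure.ae_ae_of_ae_prod (Lp.coeFn_add K K')] with ℓ h1 h2 h3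
    refine ⟨fun hI => ?_, fun hI => ?_⟩
    · obtain ⟨v, hv⟩ := h1.1 hI
      obtain ⟨w, hw⟩ := h2.1 hI
      refine ⟨v + w, ?_⟩
      have h0 := (Measure.quasiMeasurePreserving_fst (μ := (volume : Measure (Fin d → ℝ)))
        (ν := (volume : Measure (Fin d → ℝ)))).ae (Lp.coeFn_add v w)
      filter_upwards [hv, hw, h3, h0] with p hp1 hp2 hp3 hp0
      rw [hp3, hp0, Pi.add_apply, Pi.add_apply, hp1, hp2, add_mul]
    · filter_upwards [h1.2 hI, h2.2 hI, h3] with p hp1 hp2 hp3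
      rw [hp3, Pi.add_apply, hp1, hp2, add_zero]
  smul_mem' := by
    intro c K hK
    filter_upwards [hK, Measure.ae_ae_of_ae_prod (Lp.coeFn_smul c K)] with ℓ h1 h3
    refine ⟨fun hI => ?_, fun hI => ?_⟩
    · obtain ⟨v, hv⟩ := h1.1 hI
      refine ⟨c • v, ?_⟩
      have h0 := (Measure.quasiMeasurePreserving_fst (μ := (volume : Measure (Fin d → ℝ)))
        (ν := (volume : Measure (Fin d → ℝ)))).ae (Lp.coeFn_smul c v)
      filter_upwards [hv, h3, h0] with p hp1 hp3 hp0
      rw [hp3, hp0, Pi.smul_apply, Pi.smul_apply, hp1, smul_mul_assoc]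
    · filter_upwards [h1.2 hI, h3] with p hp1 hp3
      rw [hp3, Pi.smul_apply, hp1, smul_zero]

/-- The multiplicity-free band-limited space `H = P⁻¹(∫^⊕_I L²(ℝ^d) ⊗ u dμ(ℓ))` in `L²(N)`. -/
def bandLimitedSpace (I : Set (Fin m → ℝ)) (u : L2R d) : Submodule ℂ e.L2N :=
  (e.plancherelGraph ⊓ (e.rankOneField I u).comap (LinearMap.snd ℂ e.L2N e.L2Sigma)).map
    (LinearMap.fst ℂ e.L2N e.L2Sigma)

end AdaptedBasis

/-- The family `f` of vectors of a Hilbert space is a Parseval frame in its subspace `H`. -/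
def IsParsevalFrame {E ι : Type*} [NormedAddCommGroup E] [InnerProductSpace ℂ E]
    (H : Submodule ℂ E) (f : ι → E) : Prop :=
  (∀ i, f i ∈ H) ∧ ∀ x ∈ H, HasSum (fun i => ‖inner ℂ (f i) x‖ ^ 2) (‖x‖ ^ 2)

end

/-!
In the coordinates `((z, y), x)` the Plancherel transform of `f` has at `ℓ` the integral kernel
`(t, s) ↦ ∫∫ f(z, y, t - s) exp (2πi (⟨ℓ, z⟩ + ⟨B(ℓ)ᵀ t, y⟩)) dz dy`. It is thus the partial
Fourier transform in `(z, y)`, followed by the change of variables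
`(ℓ, t, s) ↦ ((ℓ, B(ℓ)ᵀ t), t - s)`, which carries `|det B(ℓ)| dℓ dt ds` to Lebesgue measure. So it
is unitary, and it turns left translation by `n` into the operator `π_ℓ(n)` acting on the variable
`t` of the kernels.

For `J ⊆ I` of finite measure let `ψ` be the inverse transform of the field `1_J(ℓ) u ⊗ u`; then
`ψ ∈ H` and `‖ψ‖² = μ(J)`. The matrix coefficient `n ↦ ⟨ψ, L(n) η⟩` is again a partial Fourier
transform up to a change of variables, so Plancherel and Cauchy-Schwarz bound its squared `L²` norm
by `‖η‖² ≤ 1`. On the other hand the frame identity for `L(n)⁻¹ ψ` says that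
`∑ |⟨ψ, L(nγ) η⟩|² = μ(J)` for every `n`. Integrating it over a box of volume
`1 / (∏ q_j ∏ b_j ∏ a_k)`, whose right translates by the quasi-lattice are disjoint, gives
`μ(J) ≤ ∏ q_j ∏ b_j ∏ a_k`.
-/

noncomputable section

/-! ### Measure theory -/

section SquareIntegrable

variable {α β E : Type*} [MeasurableSpace α] [MeasurableSpace β] [NormedAddCommGroup E]
  {μ : Measure α} {ν : Measure β}

theorem lintegral_enorm_sq (f : α → E) : ∫⁻ x, ‖f x‖ₑ ^ 2 ∂μ = eLpNorm f 2 μ ^ 2 := by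
  simpa using (eLpNorm_nnreal_pow_eq_lintegral (f := f) (μ := μ) (p := 2) two_ne_zero).symm

theorem memLp_two_of_lintegral_enorm_sq_le {f : α → E} (hf : AEStronglyMeasurable f μ) {c : ℝ≥0∞}
    (hc : c ≠ ⊤) (h : ∫⁻ x, ‖f x‖ₑ ^ 2 ∂μ ≤ c) : MemLp f 2 μ := by
  refine ⟨hf, lt_top_iff_ne_top.2 fun htop => hc ?_⟩
  rw [lintegral_enorm_sq, htop] at h
  simpa using h

theorem Lp_enorm_sq (f : Lp E 2 μ) : ‖f‖ₑ ^ 2 = ∫⁻ x, ‖f x‖ₑ ^ 2 ∂μ := by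
  rw [lintegral_enorm_sq, ← Lp.enorm_def]

theorem integral_comp_of_measurePreserving [NormedSpace ℝ E] {f : α → β}
    (hf : MeasurePreserving f μ ν) {g : β → E} (hg : AEStronglyMeasurable g ν) :
    ∫ x, g (f x) ∂μ = ∫ y, g y ∂ν := by
  rw [← hf.map_eq] at hg ⊢
  exact (integral_map hf.aemeasurable hg).symm

theorem ae_eq_prod_iff_ae_ae_eq [SFinite ν] {f g : α × β → E}
    (hf : AEStronglyMeasurable f (μ.prod ν)) (hg : AEStronglyMeasurable g (μ.prod ν)) :
    f =ᵐ[μ.prod ν] g ↔ ∀ᵐ x ∂μ, ∀ᵐ y ∂ν, f (x, y) = g (x, y) := by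
  refine ⟨Measure.ae_ae_of_ae_prod, fun h => ?_⟩
  have hs : MeasurableSet {p | hf.mk f p = hg.mk g p} :=
    hf.stronglyMeasurable_mk.measurableSet_eq_fun hg.stronglyMeasurable_mk
  have hmk : ∀ᵐ p ∂(μ.prod ν), hf.mk f p = hg.mk g p := by
    refine (Measure.ae_prod_mem_iff_ae_ae_mem hs).2 ?_
    filter_upwards [h, Measure.ae_ae_of_ae_prod hf.ae_eq_mk,
      Measure.ae_ae_of_ae_prod hg.ae_eq_mk] with x hx hfx hgx
    filter_upwards [hx, hfx, hgx] with y hy hfy hgy using hfy.symm.trans (hy.trans hgy)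
  filter_upwards [hmk, hf.ae_eq_mk, hg.ae_eq_mk] with p hp hfp hgp
    using hfp.trans (hp.trans hgp.symm)

theorem ae_memLp_prodMk_left [SFinite μ] [SFinite ν] {p : ℝ≥0∞} (hp : p ≠ 0) (hp' : p ≠ ⊤)
    {f : α × β → E} (hf : MemLp f p (μ.prod ν)) : ∀ᵐ x ∂μ, MemLp (fun y => f (x, y)) p ν := by
  filter_upwards [hf.1.prodMk_left, ((integrable_norm_rpow_iff hf.1 hp hp').2 hf).prod_right_ae]
    with x hx hx'
  exact (integrable_norm_rpow_iff hx hp hp').1 hx'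

theorem ae_memLp_prodMk_right [SFinite μ] [SFinite ν] {p : ℝ≥0∞} (hp : p ≠ 0) (hp' : p ≠ ⊤)
    {f : α × β → E} (hf : MemLp f p (μ.prod ν)) : ∀ᵐ y ∂ν, MemLp (fun x => f (x, y)) p μ :=
  ae_memLp_prodMk_left hp hp' (hf.comp_measurePreserving Measure.measurePreserving_swap)

theorem lintegral_enorm_sq_mul_prod {𝕜 : Type*} [RCLike 𝕜] [SFinite ν] {f : α → 𝕜} {g : β → 𝕜}
    (hf : AEStronglyMeasurable f μ) (hg : AEStronglyMeasurable g ν) :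
    ∫⁻ p, ‖f p.1 * g p.2‖ₑ ^ 2 ∂(μ.prod ν) =
      (∫⁻ x, ‖f x‖ₑ ^ 2 ∂μ) * ∫⁻ y, ‖g y‖ₑ ^ 2 ∂ν := by
  simp only [enorm_mul, mul_pow]
  exact lintegral_prod_mul (hf.enorm.pow_const 2) (hg.enorm.pow_const 2)

theorem memLp_two_mul_prod {𝕜 : Type*} [RCLike 𝕜] [SFinite ν] {f : α → 𝕜} {g : β → 𝕜}
    (hf : MemLp f 2 μ) (hg : MemLp g 2 ν) : MemLp (fun p => f p.1 * g p.2) 2 (μ.prod ν) := by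
  refine (memLp_two_iff_integrable_sq_norm (hf.1.comp_fst.mul hg.1.comp_snd)).2 ?_
  have h := ((memLp_two_iff_integrable_sq_norm hf.1).1 hf).mul_prod
    ((memLp_two_iff_integrable_sq_norm hg.1).1 hg)
  simpa only [Pi.mul_apply, norm_mul, mul_pow] using h

theorem ae_eq_zero_of_forall_setIntegral_prod_eq_zero [NormedSpace ℝ E] [CompleteSpace E]
    {ρ : Measure (α × β)} {h : α × β → E} (hi : Integrable h ρ)
    (h0 : ∀ A B, MeasurableSet A → MeasurableSet B → ∫ p in A ×ˢ B, h p ∂ρ = 0) :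
    h =ᵐ[ρ] 0 := by
  refine hi.ae_eq_zero_of_forall_setIntegral_eq_zero fun s hs _ => ?_
  refine MeasurableSpace.induction_on_inter (C := fun s _ => ∫ p in s, h p ∂ρ = 0)
    generateFrom_prod.symm isPiSystem_prod (by simp) ?_ ?_ ?_ s hs
  · rintro _ ⟨A, hA, B, hB, rfl⟩
    exact h0 A B hA hB
  · intro t ht ih
    have h1 := integral_add_compl ht hi
    rwa [ih, zero_add, ← setIntegral_univ (μ := ρ), ← Set.univ_prod_univ,
      h0 _ _ .univ .univ] at h1
  · intro f hd hf ih
    rw [integral_iUnion hf hd hi.integrableOn]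
    simp only [ih, tsum_zero]

theorem ae_eq_zero_of_forall_setIntegral_finite_prod_eq_zero [NormedSpace ℝ E] [CompleteSpace E]
    [SigmaFinite μ] [SigmaFinite ν] {p : ℝ≥0∞} (hp : 1 ≤ p) {h : α × β → E}
    (hh : MemLp h p (μ.prod ν))
    (h0 : ∀ A B, MeasurableSet A → MeasurableSet B → μ A < ⊤ → ν B < ⊤ →
      ∫ p in A ×ˢ B, h p ∂(μ.prod ν) = 0) : h =ᵐ[μ.prod ν] 0 := by
  set S := spanningSets μ
  set T := spanningSets ν
  have hfin : ∀ {A : Set α} {n}, μ (A ∩ S n) < ⊤ := fun {A n} =>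
    (measure_mono Set.inter_subset_right).trans_lt (measure_spanningSets_lt_top μ n)
  have hfin' : ∀ {B : Set β} {n}, ν (B ∩ T n) < ⊤ := fun {B n} =>
    (measure_mono Set.inter_subset_right).trans_lt (measure_spanningSets_lt_top ν n)
  have key : ∀ n, ∀ᵐ p ∂(μ.prod ν).restrict (S n ×ˢ T n), h p = 0 := fun n => by
    have : IsFiniteMeasure ((μ.prod ν).restrict (S n ×ˢ T n)) := ⟨by
      rw [Measure.restrict_apply_univ, Measure.prod_prod]
      exact ENNReal.mul_lt_top (measure_spanningSets_lt_top μ n) (measure_spanningSets_lt_top ν n)⟩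
    refine ae_eq_zero_of_forall_setIntegral_prod_eq_zero ((hh.restrict _).integrable hp)
      fun A B hA hB => ?_
    rw [Measure.restrict_restrict (hA.prod hB), Set.prod_inter_prod]
    exact h0 _ _ (hA.inter (measurableSet_spanningSets μ n))
      (hB.inter (measurableSet_spanningSets ν n)) hfin hfin'
  have hU : ⋃ n, S n ×ˢ T n = Set.univ := by
    rw [Set.iUnion_prod_of_monotone (monotone_spanningSets μ) (monotone_spanningSets ν),
      iUnion_spanningSets, iUnion_spanningSets, Set.univ_prod_univ]
  have h1 := (ae_restrict_iUnion_iff (μ := μ.prod ν) (fun n => S n ×ˢ T n) fun p => h p = 0).2 key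
  rwa [hU, Measure.restrict_univ] at h1

end SquareIntegrable

/-! ### Fourier integrals -/

section Fourier

open FourierTransform SchwartzMap
open scoped ContDiff RealInnerProductSpace

section EuclideanSpace

variable {E : Type*} [NormedAddCommGroup E] [InnerProductSpace ℝ E] [FiniteDimensional ℝ E]
  [MeasurableSpace E] [BorelSpace E]

-- Both sides are the same tempered distribution.
theorem fourier_toLp_ae_eq {f : E → ℂ} (h1 : Integrable f) (h2 : MemLp f 2) :
    (𝓕 (h2.toLp f) : Lp ℂ 2 (volume : Measure E)) =ᵐ[volume] 𝓕 f := by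
  have hcont : Continuous (𝓕 f) := VectorFourier.fourierIntegral_continuous
    Real.continuous_fourierChar continuous_inner h1
  refine ae_eq_of_integral_contDiff_smul_eq
    ((Lp.memLp _).locallyIntegrable one_le_two) hcont.locallyIntegrable fun g hg hgs => ?_
  have hgs' : HasCompactSupport (Complex.ofRealCLM ∘ g) := hgs.comp_left rfl
  have hg' : ContDiff ℝ ∞ (Complex.ofRealCLM ∘ g) := by fun_prop
  set φ : 𝓢(E, ℂ) := hgs'.toSchwartzMap hg'
  have hφ : ∀ x (z : ℂ), g x • z = φ x • z := fun x z => (Complex.coe_smul (g x) z).symm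
  have hdist := congrArg (fun T => T φ) (Lp.fourier_toTemperedDistribution_eq (h2.toLp f))
  simp only [TemperedDistribution.fourier_apply, Lp.toTemperedDistribution_apply] at hdist
  have hflip := VectorFourier.integral_fourierIntegral_smul_eq_flip (μ := (volume : Measure E))
    (ν := (volume : Measure E)) (L := innerₗ E) Real.continuous_fourierChar
    continuous_inner φ.integrable h1
  rw [flip_innerₗ] at hflip
  simp only [hφ]
  rw [← hdist]
  refine Eq.trans (integral_congr_ae ?_) hflip
  filter_upwards [h2.coeFn_toLp] with x hx
  rw [hx]
  rfl

theorem lintegral_fourier_enorm_sq {f : E → ℂ} (h1 : Integrable f) (h2 : MemLp f 2) :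
    ∫⁻ x, ‖𝓕 f x‖ₑ ^ 2 = ∫⁻ x, ‖f x‖ₑ ^ 2 := by
  have hnorm : ‖𝓕 (h2.toLp f)‖ₑ = ‖h2.toLp f‖ₑ := by
    rw [← ofReal_norm, ← ofReal_norm, Lp.norm_fourier_eq]
  rw [lintegral_enorm_sq, lintegral_enorm_sq, ← eLpNorm_congr_ae (fourier_toLp_ae_eq h1 h2),
    ← Lp.enorm_def, hnorm, Lp.enorm_def, eLpNorm_congr_ae h2.coeFn_toLp]

theorem lintegral_fourierInv_enorm_sq {f : E → ℂ} (h1 : Integrable f) (h2 : MemLp f 2) :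
    ∫⁻ x, ‖𝓕⁻ f x‖ₑ ^ 2 = ∫⁻ x, ‖f x‖ₑ ^ 2 := by
  simp only [← lintegral_fourier_enorm_sq h1 h2, Real.fourierInv_eq_fourier_neg]
  exact (LinearIsometryEquiv.neg ℝ (E := E)).measurePreserving.lintegral_comp_emb
    (LinearIsometryEquiv.neg ℝ).toHomeomorph.measurableEmbedding fun x => ‖𝓕 f x‖ₑ ^ 2

end EuclideanSpace

variable {ι κ : Type*} [Fintype ι] [Fintype κ]

/-- The character `p ↦ exp (2 π i ⟨w, p⟩)` of `ℝ^ι × ℝ^κ`. -/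
def pairChar (w p : (ι → ℝ) × (κ → ℝ)) : ℂ :=
  Complex.exp (2 * Real.pi * Complex.I * (w.1 ⬝ᵥ p.1 + w.2 ⬝ᵥ p.2 : ℝ))

theorem norm_pairChar (w p : (ι → ℝ) × (κ → ℝ)) : ‖pairChar w p‖ = 1 :=
  AdaptedBasis.norm_phase _

theorem measurable_pairChar {α : Type*} [MeasurableSpace α] {f g : α → (ι → ℝ) × (κ → ℝ)}
    (hf : Measurable f) (hg : Measurable g) : Measurable fun x => pairChar (f x) (g x) := by
  unfold pairChar dotProduct
  fun_prop

/-- The Fourier integral on `ℝ^ι × ℝ^κ`, with the positive sign in the exponent. -/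
def charIntegral (g : (ι → ℝ) × (κ → ℝ) → ℂ) (w : (ι → ℝ) × (κ → ℝ)) : ℂ :=
  ∫ p, pairChar w p * g p

/-- `ℝ^ι × ℝ^κ` with its Euclidean norm, on which Mathlib's Fourier transform is defined. -/
abbrev EuclideanProd (ι κ : Type*) [Fintype ι] [Fintype κ] : Type _ :=
  WithLp 2 (EuclideanSpace ℝ ι × EuclideanSpace ℝ κ)

namespace EuclideanProd

/-- The identification of the Euclidean space `ℝ^ι × ℝ^κ` with the product of function spaces. -/
def equivProd (ι κ : Type*) [Fintype ι] [Fintype κ] :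
    EuclideanProd ι κ ≃L[ℝ] (ι → ℝ) × (κ → ℝ) :=
  (WithLp.prodContinuousLinearEquiv 2 ℝ _ _).trans
    ((EuclideanSpace.equiv ι ℝ).prodCongr (EuclideanSpace.equiv κ ℝ))

theorem measurableEmbedding_equivProd : MeasurableEmbedding (equivProd ι κ) :=
  (equivProd ι κ).toHomeomorph.measurableEmbedding

theorem measurePreserving_equivProd : MeasurePreserving (equivProd ι κ) := by
  have h : MeasurePreserving (Prod.map (WithLp.ofLp : EuclideanSpace ℝ ι → _)
      (WithLp.ofLp : EuclideanSpace ℝ κ → _)) :=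
    (PiLp.volume_preserving_ofLp ι).prod (PiLp.volume_preserving_ofLp κ)
  exact h.comp (WithLp.volume_preserving_ofLp (EuclideanSpace ℝ ι) (EuclideanSpace ℝ κ))

theorem inner_eq_dotProduct (x y : EuclideanProd ι κ) : ⟪x, y⟫ =
    (equivProd ι κ y).1 ⬝ᵥ (equivProd ι κ x).1 + (equivProd ι κ y).2 ⬝ᵥ (equivProd ι κ x).2 := by
  simp [WithLp.prod_inner_apply, PiLp.inner_apply, equivProd, dotProduct]

end EuclideanProd

open EuclideanProd

theorem charIntegral_equivProd (g : (ι → ℝ) × (κ → ℝ) → ℂ) (x : EuclideanProd ι κ) :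
    charIntegral g (equivProd ι κ x) = 𝓕⁻ (g ∘ equivProd ι κ) x := by
  rw [charIntegral, ← measurePreserving_equivProd.integral_comp measurableEmbedding_equivProd,
    Real.fourierInv_eq']
  simp only [pairChar, Function.comp_apply, smul_eq_mul, inner_eq_dotProduct]
  push_cast
  simp only [mul_right_comm]

theorem lintegral_charIntegral_enorm_sq {g : (ι → ℝ) × (κ → ℝ) → ℂ} (h1 : Integrable g)
    (h2 : MemLp g 2) : ∫⁻ w, ‖charIntegral g w‖ₑ ^ 2 = ∫⁻ p, ‖g p‖ₑ ^ 2 := by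
  have mp := measurePreserving_equivProd (ι := ι) (κ := κ)
  have me := measurableEmbedding_equivProd (ι := ι) (κ := κ)
  rw [← mp.lintegral_comp_emb me, ← mp.lintegral_comp_emb me]
  simp only [charIntegral_equivProd]
  exact lintegral_fourierInv_enorm_sq ((mp.integrable_comp_emb me).2 h1)
    (h2.comp_measurePreserving mp)

theorem lintegral_charIntegral_enorm_sq_le {g : (ι → ℝ) × (κ → ℝ) → ℂ} (h1 : Integrable g) :
    ∫⁻ w, ‖charIntegral g w‖ₑ ^ 2 ≤ ∫⁻ p, ‖g p‖ₑ ^ 2 := by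
  by_cases h : eLpNorm g 2 volume < ⊤
  · exact (lintegral_charIntegral_enorm_sq h1 ⟨h1.1, h⟩).le
  · rw [lintegral_enorm_sq g, not_lt_top_iff.1 h]
    simp

theorem exists_charIntegral_eq {φ : (ι → ℝ) × (κ → ℝ) → ℝ} (hφ : ContDiff ℝ ∞ φ)
    (hs : HasCompactSupport φ) : ∃ g : (ι → ℝ) × (κ → ℝ) → ℂ,
      Integrable g ∧ MemLp g 2 ∧ charIntegral g = fun w => (φ w : ℂ) := by
  set ε := equivProd ι κ
  have hs' : HasCompactSupport (Complex.ofRealCLM ∘ φ ∘ ε) :=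
    (hs.comp_homeomorph ε.toHomeomorph).comp_left rfl
  have hφ' : ContDiff ℝ ∞ (Complex.ofRealCLM ∘ φ ∘ ε) := by fun_prop
  set Φ : 𝓢(EuclideanProd ι κ, ℂ) := hs'.toSchwartzMap hφ'
  set Ψ : 𝓢(EuclideanProd ι κ, ℂ) := 𝓕 Φ
  have mp : MeasurePreserving ε.symm :=
    measurePreserving_equivProd.symm ε.toHomeomorph.toMeasurableEquiv
  have me : MeasurableEmbedding ε.symm := ε.symm.toHomeomorph.measurableEmbedding
  refine ⟨Ψ ∘ ε.symm, (mp.integrable_comp_emb me).2 Ψ.integrable,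
    (Ψ.memLp 2 volume).comp_measurePreserving mp, funext fun w => ?_⟩
  obtain ⟨x, rfl⟩ := ε.surjective w
  have hcomp : (Ψ ∘ ε.symm) ∘ ε = Ψ := by ext; simp
  rw [charIntegral_equivProd, hcomp, ← SchwartzMap.fourierInv_coe, fourierInv_fourier_eq]
  rfl

end Fourier

/-! ### Partial Fourier transforms -/

section PartialFourier

open scoped ContDiff

variable {ι κ X : Type*} [Fintype ι] [Fintype κ]

/-- The Fourier integral of a function on `(ℝ^ι × ℝ^κ) × X` in the first variable. -/
def partialFourier (f : ((ι → ℝ) × (κ → ℝ)) × X → ℂ) (p : ((ι → ℝ) × (κ → ℝ)) × X) : ℂ :=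
  charIntegral (fun v => f (v, p.2)) p.1

theorem partialFourier_mul (g : (ι → ℝ) × (κ → ℝ) → ℂ) (k : X → ℂ)
    (p : ((ι → ℝ) × (κ → ℝ)) × X) :
    partialFourier (fun p => g p.1 * k p.2) p = charIntegral g p.1 * k p.2 := by
  simp only [partialFourier, charIntegral, ← mul_assoc, integral_mul_const]

variable [MeasurableSpace X] {ν : Measure X}

theorem measurable_partialFourier {f : ((ι → ℝ) × (κ → ℝ)) × X → ℂ} (hf : Measurable f) :
    Measurable (partialFourier f) := by
  refine (StronglyMeasurable.integral_prod_right'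
    (f := fun r : (((ι → ℝ) × (κ → ℝ)) × X) × ((ι → ℝ) × (κ → ℝ)) =>
      pairChar r.1.1 r.2 * f (r.2, r.1.2)) (Measurable.stronglyMeasurable ?_)).measurable
  exact (measurable_pairChar (by fun_prop) (by fun_prop)).mul (hf.comp (by fun_prop))

theorem lintegral_partialFourier_enorm_sq_le [SFinite ν] {f : ((ι → ℝ) × (κ → ℝ)) × X → ℂ}
    (hf : Measurable f) (hi : ∀ᵐ x ∂ν, Integrable fun v => f (v, x)) :
    ∫⁻ p, ‖partialFourier f p‖ₑ ^ 2 ∂(volume.prod ν) ≤ ∫⁻ p, ‖f p‖ₑ ^ 2 ∂(volume.prod ν) := by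
  have hm : Measurable fun p => ‖partialFourier f p‖ₑ ^ 2 :=
    (measurable_partialFourier hf).enorm.pow_const 2
  have hm' : Measurable fun p => ‖f p‖ₑ ^ 2 := hf.enorm.pow_const 2
  rw [lintegral_prod_symm' _ hm, lintegral_prod_symm' _ hm']
  refine lintegral_mono_ae ?_
  filter_upwards [hi] with x hx
  exact lintegral_charIntegral_enorm_sq_le (g := fun v => f (v, x)) hx

theorem ae_forall_partialFourier_eq [SFinite ν] {f g : ((ι → ℝ) × (κ → ℝ)) × X → ℂ}
    (h : f =ᵐ[volume.prod ν] g) :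
    ∀ᵐ x ∂ν, ∀ w, partialFourier f (w, x) = partialFourier g (w, x) := by
  filter_upwards [Measure.ae_ae_of_ae_prod
    (Measure.measurePreserving_swap.quasiMeasurePreserving.ae h)] with x hx w
  refine integral_congr_ae ?_
  filter_upwards [hx] with v hv using congrArg _ hv

theorem partialFourier_congr_ae [SFinite ν] {f g : ((ι → ℝ) × (κ → ℝ)) × X → ℂ}
    (h : f =ᵐ[volume.prod ν] g) : partialFourier f =ᵐ[volume.prod ν] partialFourier g := by
  filter_upwards [Measure.quasiMeasurePreserving_snd.ae (ae_forall_partialFourier_eq h)]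
    with p hp using hp p.1

theorem aestronglyMeasurable_partialFourier [SFinite ν] {f : ((ι → ℝ) × (κ → ℝ)) × X → ℂ}
    (hf : AEStronglyMeasurable f (volume.prod ν)) :
    AEStronglyMeasurable (partialFourier f) (volume.prod ν) :=
  (measurable_partialFourier
    hf.stronglyMeasurable_mk.measurable).aestronglyMeasurable.congr
      (partialFourier_congr_ae hf.ae_eq_mk).symm

theorem lintegral_partialFourier_enorm_sq [SFinite ν] {f : ((ι → ℝ) × (κ → ℝ)) × X → ℂ}
    (h1 : Integrable f (volume.prod ν)) (h2 : MemLp f 2 (volume.prod ν)) :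
    ∫⁻ p, ‖partialFourier f p‖ₑ ^ 2 ∂(volume.prod ν) = ∫⁻ p, ‖f p‖ₑ ^ 2 ∂(volume.prod ν) := by
  have hm : AEMeasurable (fun p => ‖partialFourier f p‖ₑ ^ 2) (volume.prod ν) :=
    (aestronglyMeasurable_partialFourier h1.1).enorm.pow_const 2
  have hm' : AEMeasurable (fun p => ‖f p‖ₑ ^ 2) (volume.prod ν) := h1.1.enorm.pow_const 2
  rw [lintegral_prod_symm _ hm, lintegral_prod_symm _ hm']
  refine lintegral_congr_ae ?_
  filter_upwards [h1.prod_left_ae, ae_memLp_prodMk_right two_ne_zero ENNReal.ofNat_ne_top h2]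
    with x hx1 hx2
  exact lintegral_charIntegral_enorm_sq (g := fun v => f (v, x)) hx1 hx2

theorem memLp_partialFourier [SFinite ν] {f : ((ι → ℝ) × (κ → ℝ)) × X → ℂ}
    (h1 : Integrable f (volume.prod ν)) (h2 : MemLp f 2 (volume.prod ν)) :
    MemLp (partialFourier f) 2 (volume.prod ν) := by
  refine memLp_two_of_lintegral_enorm_sq_le (aestronglyMeasurable_partialFourier h1.1)
    ?_ (lintegral_partialFourier_enorm_sq h1 h2).le
  rw [lintegral_enorm_sq]
  exact ENNReal.pow_ne_top h2.2.ne

theorem exists_partialFourier_eq_mul_indicator [SFinite ν] {φ : (ι → ℝ) × (κ → ℝ) → ℝ}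
    (hφ : ContDiff ℝ ∞ φ) (hs : HasCompactSupport φ) {B : Set X} (hB : MeasurableSet B)
    (hB' : ν B ≠ ⊤) : ∃ f : ((ι → ℝ) × (κ → ℝ)) × X → ℂ, Integrable f (volume.prod ν) ∧
      MemLp f 2 (volume.prod ν) ∧ ∀ p, partialFourier f p = φ p.1 * B.indicator 1 p.2 := by
  obtain ⟨g, hg1, hg2, hg⟩ := exists_charIntegral_eq hφ hs
  have hi : Integrable (B.indicator (1 : X → ℂ)) ν :=
    (integrable_indicator_iff hB).2 (integrableOn_const hB')
  exact ⟨fun p => g p.1 * B.indicator 1 p.2, hg1.mul_prod hi,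
    memLp_two_mul_prod hg2 (memLp_indicator_const 2 hB 1 (Or.inr hB')), fun p => by
      rw [partialFourier_mul, hg]⟩

theorem ae_eq_zero_of_forall_integral_partialFourier_mul_eq_zero [SigmaFinite ν]
    {h : ((ι → ℝ) × (κ → ℝ)) × X → ℂ} (hh : MemLp h 2 (volume.prod ν))
    (h0 : ∀ f : ((ι → ℝ) × (κ → ℝ)) × X → ℂ, Integrable f (volume.prod ν) →
      MemLp f 2 (volume.prod ν) → ∫ p, partialFourier f p * h p ∂(volume.prod ν) = 0) :
    h =ᵐ[volume.prod ν] 0 := by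
  refine ae_eq_zero_of_forall_setIntegral_finite_prod_eq_zero one_le_two hh
    fun A B _ hB hA' hB' => ?_
  have hint : ∀ K : Set ((ι → ℝ) × (κ → ℝ)), volume K < ⊤ →
      IntegrableOn h (K ×ˢ B) (volume.prod ν) := fun K hK => by
    have : IsFiniteMeasure ((volume.prod ν).restrict (K ×ˢ B)) := ⟨by
      rw [Measure.restrict_apply_univ, Measure.prod_prod]
      exact ENNReal.mul_lt_top hK hB'⟩
    exact (hh.restrict _).integrable one_le_two
  have hloc : LocallyIntegrable fun v => ∫ x in B, h (v, x) ∂ν := by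
    refine locallyIntegrable_iff.2 fun K hK => ?_
    have := hint K hK.measure_lt_top
    rw [IntegrableOn, ← Measure.prod_restrict] at this
    exact this.integral_prod_left
  have hzero : ∀ᵐ v, ∫ x in B, h (v, x) ∂ν = 0 := by
    refine ae_eq_zero_of_integral_contDiff_smul_eq_zero hloc fun φ hφ hφs => ?_
    obtain ⟨f, hf1, hf2, hf⟩ := exists_partialFourier_eq_mul_indicator hφ hφs hB hB'.ne
    have hi := (memLp_partialFourier hf1 hf2).integrable_mul hh
    refine Eq.trans ?_ ((integral_prod _ hi).symm.trans (h0 f hf1 hf2))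
    refine integral_congr_ae (.of_forall fun v => ?_)
    simp only [Pi.mul_apply, hf, Complex.real_smul, ← integral_indicator hB, ← integral_const_mul]
    refine integral_congr_ae (.of_forall fun x => ?_)
    by_cases hx : x ∈ B <;> simp [hx]
  rw [setIntegral_prod _ (hint A hA')]
  exact integral_eq_zero_of_ae (ae_restrict_of_ae hzero)

end PartialFourier

/-! ### The cross-section and the Plancherel measure -/

theorem measurePreserving_of_ae_leftInverse {α β : Type*} [MeasurableSpace α] [MeasurableSpace β]
    {μ : Measure α} {ν : Measure β} {f : α → β} {g : β → α} (hf : MeasurePreserving f μ ν)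
    (hg : Measurable g) (h : ∀ᵐ x ∂μ, g (f x) = x) : MeasurePreserving g ν μ := by
  refine ⟨hg, ?_⟩
  rw [← hf.map_eq, Measure.map_map hg hf.measurable,
    Measure.map_congr (g := id) (by filter_upwards [h] with x hx using hx), Measure.map_id]

theorem volume_preimage_mulVec {ι : Type*} [Fintype ι] [DecidableEq ι] {M : Matrix ι ι ℝ}
    (hM : M.det ≠ 0) (s : Set (ι → ℝ)) :
    volume ((fun t => M *ᵥ t) ⁻¹' s) = ENNReal.ofReal |M.det|⁻¹ * volume s := by
  have h := Measure.addHaar_preimage_linearMap volume (f := Matrix.toLin' M)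
    (by rwa [LinearMap.det_toLin']) s
  rwa [LinearMap.det_toLin', abs_inv] at h

section

open Polynomial

theorem finite_setOf_det_add_smul_eq_zero {K ι : Type*} [Field K] [Fintype ι] [DecidableEq ι]
    {A : Matrix ι ι K} (hA : A.det ≠ 0) (B : Matrix ι ι K) :
    {c : K | (B + c • A).det = 0}.Finite := by
  have hp : det ((X : K[X]) • A.map C + B.map C) ≠ 0 := fun h => hA <| by
    rw [← coeff_det_X_add_C_card A B, h, coeff_zero]
  refine (finite_setOfPred_isRoot hp).subset fun c (hc : (B + c • A).det = 0) => ?_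
  have hmap : (evalRingHom c).mapMatrix ((X : K[X]) • A.map C + B.map C) = B + c • A := by
    ext i j
    simp [add_comm, mul_comm c]
  rw [Set.mem_ofPred_eq, IsRoot, ← coe_evalRingHom, RingHom.map_det, hmap, hc]

end

namespace AdaptedBasis

variable {𝔫 : Type*} [LieRing 𝔫] [LieAlgebra ℝ 𝔫] {m d : ℕ} (e : AdaptedBasis 𝔫 m d)

theorem functional_apply (ℓ : Fin m → ℝ) (v : 𝔫) : e.functional ℓ v = ℓ ⬝ᵥ e.zRepr v := by
  simp [functional, dotProduct, zRepr]

theorem continuous_matrixV : Continuous e.matrixV := by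
  refine continuous_matrix fun i j => ?_
  simp only [matrixV, Matrix.of_apply, functional_apply, dotProduct]
  fun_prop

theorem continuous_matrixB : Continuous e.matrixB := by
  refine continuous_matrix fun i j => ?_
  simp only [matrixB, Matrix.of_apply, functional_apply, dotProduct]
  fun_prop

theorem measurable_ofReal_abs_det_matrixB :
    Measurable fun ℓ => ENNReal.ofReal |(e.matrixB ℓ).det| :=
  e.continuous_matrixB.matrix_det.abs.measurable.ennreal_ofReal

theorem matrixV_add_smul (ℓ ℓ' : Fin m → ℝ) (c : ℝ) :
    e.matrixV (ℓ + c • ℓ') = e.matrixV ℓ + c • e.matrixV ℓ' := by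
  ext i j
  simp [matrixV, functional_apply, add_dotProduct, smul_dotProduct]

theorem matrixV_eq_fromBlocks (ℓ : Fin m → ℝ) :
    e.matrixV ℓ = Matrix.fromBlocks 0 (e.matrixB ℓ)ᵀ (-e.matrixB ℓ) 0 := by
  ext i j
  rcases i with i | i <;> rcases j with j | j
  · simp [matrixV, e.lie_Y]
  · rw [Matrix.fromBlocks_apply₁₂, matrixV, Matrix.of_apply, ← lie_skew]
    simp only [matrixB, X, Y, Matrix.transpose_apply, Matrix.of_apply, map_neg]
  · simp [matrixV, matrixB, X, Y]
  · simp [matrixV, e.lie_X]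

theorem det_matrixB_ne_zero {ℓ : Fin m → ℝ} (h : ℓ ∈ e.crossSection) :
    (e.matrixB ℓ).det ≠ 0 := by
  intro h0
  obtain ⟨y, hy, hBy⟩ := Matrix.exists_mulVec_eq_zero_iff.2 h0
  refine h (Matrix.exists_mulVec_eq_zero_iff.1 ⟨Sum.elim y 0, fun hz => hy ?_, ?_⟩)
  · exact funext fun i => congrFun hz (Sum.inl i)
  · ext (i | i) <;> simp [matrixV_eq_fromBlocks, Matrix.fromBlocks_mulVec, Matrix.neg_mulVec, hBy]

theorem isUnit_det_transpose_matrixB {ℓ : Fin m → ℝ} (h : ℓ ∈ e.crossSection) :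
    IsUnit ((e.matrixB ℓ)ᵀ).det := by
  rw [Matrix.det_transpose]
  exact isUnit_iff_ne_zero.2 (e.det_matrixB_ne_zero h)

theorem measurableSet_crossSection : MeasurableSet e.crossSection :=
  (isOpen_ne.preimage e.continuous_matrixV.matrix_det).measurableSet

instance : SigmaFinite e.plancherelMeasure :=
  SigmaFinite.withDensity_ofReal _

theorem ae_plancherelMeasure_mem_crossSection :
    ∀ᵐ ℓ ∂e.plancherelMeasure, ℓ ∈ e.crossSection :=
  (withDensity_absolutelyContinuous _ _).ae_le (ae_restrict_mem e.measurableSet_crossSection)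

theorem ae_plancherelMeasure_prod_mem_crossSection {β : Type*} [MeasurableSpace β]
    (ν : Measure β) : ∀ᵐ p ∂(e.plancherelMeasure.prod ν), p.1 ∈ e.crossSection :=
  Measure.quasiMeasurePreserving_fst.ae e.ae_plancherelMeasure_mem_crossSection

theorem repr_inr_eq_zero {v : 𝔫} (hv : v ∈ LieAlgebra.center ℝ 𝔫) (i : Fin d ⊕ Fin d) :
    e.basis.repr v (Sum.inr i) = 0 := by
  rw [← e.zVec_zRepr hv]
  simp [zVec, Z]

theorem dual_lie_eq_zero {f : Module.Dual ℝ 𝔫} {v : 𝔫}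
    (h : ∀ j, f ⁅v, e.basis (Sum.inr j)⁆ = 0) (w : 𝔫) : f ⁅v, w⁆ = 0 := by
  rw [← e.basis.sum_repr w, Fintype.sum_sum_type, lie_add]
  change f (⁅v, e.zVec (e.zRepr w)⁆ + _) = 0
  rw [lie_zVec, zero_add, lie_sum, map_sum]
  simp [h]

section TwoStep

variable [TwoStepLie 𝔫]

theorem functional_lie (f : Module.Dual ℝ 𝔫) (v w : 𝔫) :
    e.functional (fun k => f (e.Z k)) ⁅v, w⁆ = f ⁅v, w⁆ := by
  rw [functional_apply]
  conv_rhs => rw [← e.zVec_zRepr (lie_mem_center v w)]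
  simp [zVec, dotProduct, mul_comm]

theorem crossSection_nonempty : e.crossSection.Nonempty := by
  obtain ⟨f, hf⟩ := e.exists_flat
  refine ⟨fun k => f (e.Z k), fun h0 => ?_⟩
  obtain ⟨c, hc, hVc⟩ := Matrix.exists_vecMul_eq_zero_iff.2 h0
  set v : 𝔫 := ∑ i, c i • e.basis (Sum.inr i)
  have hv : v ∈ LieAlgebra.center ℝ 𝔫 := (hf v).1 <| e.dual_lie_eq_zero fun j => by
    simpa [Matrix.vecMul, dotProduct, matrixV, functional_lie, v, sum_lie] using congrFun hVc j
  have hrepr : ∀ i, e.basis.repr v (Sum.inr i) = c i := fun i => by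
    rcases i with i | i <;> simp [v, Finsupp.single_apply]
  exact hc (funext fun i => (hrepr i).symm.trans (e.repr_inr_eq_zero hv i))

theorem ae_mem_crossSection : ∀ᵐ ℓ : Fin m → ℝ, ℓ ∈ e.crossSection := by
  obtain ⟨ℓ₀, h₀⟩ := e.crossSection_nonempty
  refine ae_mem_of_ae_add_linearMap_mem (LinearMap.toSpanSingleton ℝ (Fin m → ℝ) ℓ₀) volume
    volume e.measurableSet_crossSection fun ℓ => ?_
  refine measure_mono_null (fun c hc => ?_)
    ((finite_setOf_det_add_smul_eq_zero h₀ (e.matrixV ℓ)).measure_zero volume)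
  simpa [crossSection, matrixV_add_smul] using hc

theorem plancherelMeasure_eq_withDensity :
    e.plancherelMeasure = volume.withDensity fun ℓ => ENNReal.ofReal |(e.matrixB ℓ).det| := by
  rw [plancherelMeasure, Measure.restrict_eq_self_of_ae_mem e.ae_mem_crossSection]

end TwoStep

/-! ### Frequency coordinates for integral kernels -/

/-- The map `(ℓ, t) ↦ (ℓ, B(ℓ)ᵀ t)`, which sends the parameters of the modulation
`exp (2 π i (⟨ℓ, z⟩ + ⟨t, B(ℓ) y⟩))` to its frequency dual to `(z, y)`. -/
def freqMap (p : (Fin m → ℝ) × (Fin d → ℝ)) : (Fin m → ℝ) × (Fin d → ℝ) :=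
  (p.1, (e.matrixB p.1)ᵀ *ᵥ p.2)

/-- The inverse of `freqMap` over the cross-section; elsewhere `B(ℓ)ᵀ` is singular and its matrix
inverse is `0`. -/
def freqInv (p : (Fin m → ℝ) × (Fin d → ℝ)) : (Fin m → ℝ) × (Fin d → ℝ) :=
  (p.1, ((e.matrixB p.1)ᵀ)⁻¹ *ᵥ p.2)

theorem measurable_freqMap : Measurable e.freqMap := by
  have := e.continuous_matrixB
  exact (continuous_fst.prodMk
    ((this.comp continuous_fst).matrix_transpose.matrix_mulVec continuous_snd)).measurable

theorem measurable_freqInv : Measurable e.freqInv := by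
  have hc := (e.continuous_matrixB.comp
    (continuous_fst (Y := Fin d → ℝ))).matrix_transpose
  refine measurable_fst.prodMk ?_
  simp only [Matrix.inv_def, Ring.inverse_eq_inv', Matrix.smul_mulVec]
  exact hc.matrix_det.measurable.inv.smul
    (hc.matrix_adjugate.matrix_mulVec continuous_snd).measurable

theorem freqInv_freqMap {p : (Fin m → ℝ) × (Fin d → ℝ)} (h : p.1 ∈ e.crossSection) :
    e.freqInv (e.freqMap p) = p := by
  simp [freqInv, freqMap, Matrix.mulVec_mulVec,
    Matrix.nonsing_inv_mul _ (e.isUnit_det_transpose_matrixB h)]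

theorem freqMap_freqInv {p : (Fin m → ℝ) × (Fin d → ℝ)} (h : p.1 ∈ e.crossSection) :
    e.freqMap (e.freqInv p) = p := by
  simp [freqInv, freqMap, Matrix.mulVec_mulVec,
    Matrix.mul_nonsing_inv _ (e.isUnit_det_transpose_matrixB h)]

/-- The map `(ℓ, t, s) ↦ ((ℓ, B(ℓ)ᵀ t), t - s)`: at these points the partial Fourier transform of
a function on `N` in the coordinates `((z, y), x)` gives the integral kernels of its
group Fourier transform. -/
def kernelMap (p : (Fin m → ℝ) × Plane d) : ((Fin m → ℝ) × (Fin d → ℝ)) × (Fin d → ℝ) :=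
  (e.freqMap (p.1, p.2.1), p.2.1 - p.2.2)

/-- The inverse of `kernelMap` over the cross-section. -/
def kernelInv (p : ((Fin m → ℝ) × (Fin d → ℝ)) × (Fin d → ℝ)) : (Fin m → ℝ) × Plane d :=
  (p.1.1, ((e.freqInv p.1).2, (e.freqInv p.1).2 - p.2))

theorem measurable_kernelInv : Measurable e.kernelInv := by
  have h : Measurable fun p : ((Fin m → ℝ) × (Fin d → ℝ)) × (Fin d → ℝ) => (e.freqInv p.1).2 :=
    (e.measurable_freqInv.comp measurable_fst).snd
  exact measurable_fst.fst.prodMk (h.prodMk (h.sub measurable_snd))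

theorem kernelInv_kernelMap {p : (Fin m → ℝ) × Plane d} (h : p.1 ∈ e.crossSection) :
    e.kernelInv (e.kernelMap p) = p := by
  have h1 := e.freqInv_freqMap (p := (p.1, p.2.1)) h
  simp only [kernelInv, kernelMap, h1]
  simp [freqMap]

theorem measurePreserving_sub_snd :
    MeasurePreserving (fun p : Plane d => (p.1, p.1 - p.2)) volume volume :=
  (MeasurePreserving.id volume).skew_product (g := fun t s : Fin d → ℝ => t - s)
    (by simp only [Function.uncurry_def]; fun_prop)
    (.of_forall fun t => (Measure.measurePreserving_sub_left volume t).map_eq)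

variable [TwoStepLie 𝔫]

theorem measurePreserving_freqMap :
    MeasurePreserving e.freqMap (e.plancherelMeasure.prod volume) volume := by
  refine ⟨e.measurable_freqMap, Measure.ext fun s hs => ?_⟩
  rw [Measure.map_apply e.measurable_freqMap hs,
    Measure.prod_apply (e.measurable_freqMap hs), Measure.volume_eq_prod, Measure.prod_apply hs,
    plancherelMeasure_eq_withDensity, lintegral_withDensity_eq_lintegral_mul _
      e.measurable_ofReal_abs_det_matrixB
      (measurable_measure_prodMk_left (e.measurable_freqMap hs))]
  refine lintegral_congr_ae ?_
  filter_upwards [e.ae_mem_crossSection] with ℓ hℓ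
  have hdet := abs_pos.2 (e.det_matrixB_ne_zero hℓ)
  have hpre := volume_preimage_mulVec (e.isUnit_det_transpose_matrixB hℓ).ne_zero
    (Prod.mk ℓ ⁻¹' s)
  rw [Matrix.det_transpose] at hpre
  refine (congrArg (ENNReal.ofReal |(e.matrixB ℓ).det| * ·) hpre).trans ?_
  rw [← mul_assoc, ← ENNReal.ofReal_mul hdet.le, mul_inv_cancel₀ hdet.ne', ENNReal.ofReal_one,
    one_mul]

theorem measurePreserving_freqInv :
    MeasurePreserving e.freqInv volume (e.plancherelMeasure.prod volume) :=
  measurePreserving_of_ae_leftInverse e.measurePreserving_freqMap e.measurable_freqInv <| by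
    filter_upwards [e.ae_plancherelMeasure_prod_mem_crossSection volume]
      with p hp using e.freqInv_freqMap hp

theorem measurePreserving_kernelMap :
    MeasurePreserving e.kernelMap (e.plancherelMeasure.prod volume) volume := by
  have h := (measurePreserving_prodAssoc e.plancherelMeasure (volume : Measure (Fin d → ℝ))
    (volume : Measure (Fin d → ℝ))).symm
  exact (e.measurePreserving_freqMap.prod (.id volume)).comp
    (h.comp ((MeasurePreserving.id e.plancherelMeasure).prod measurePreserving_sub_snd))

theorem measurePreserving_kernelInv :
    MeasurePreserving e.kernelInv volume (e.plancherelMeasure.prod volume) :=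
  measurePreserving_of_ae_leftInverse e.measurePreserving_kernelMap e.measurable_kernelInv <| by
    filter_upwards [e.ae_plancherelMeasure_prod_mem_crossSection volume]
      with p hp using e.kernelInv_kernelMap hp

/-- The chart `((z, y), x) ↦ exp (∑ z_k Z_k) exp (∑ y_j Y_j) exp (∑ x_j X_j)`, with the coordinates
of the normal subgroup `exp (span {Z_k, Y_j})` grouped together. -/
def assocChart : ((Fin m → ℝ) × (Fin d → ℝ)) × (Fin d → ℝ) ≃ᵐ NilGroup 𝔫 :=
  MeasurableEquiv.prodAssoc.trans e.chart.toMeasurableEquiv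

theorem assocChart_apply (p : ((Fin m → ℝ) × (Fin d → ℝ)) × (Fin d → ℝ)) :
    e.assocChart p = e.ofCoords (p.1.1, p.1.2, p.2) := rfl

theorem measurePreserving_assocChart : MeasurePreserving e.assocChart volume e.haar :=
  e.measurePreserving_ofCoords.comp
    (measurePreserving_prodAssoc volume volume (volume : Measure (Fin d → ℝ)))

end AdaptedBasis

/-! ### Integral kernels and matrix coefficients -/

namespace AdaptedBasis

variable {𝔫 : Type*} [LieRing 𝔫] [LieAlgebra ℝ 𝔫] {m d : ℕ} (e : AdaptedBasis 𝔫 m d)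

theorem kernelForm_indicatorConstLp (k : Plane d → ℂ) {A B : Set (Fin d → ℝ)}
    (hA : MeasurableSet A) (hB : MeasurableSet B) (hA' : volume A ≠ ⊤) (hB' : volume B ≠ ⊤) :
    kernelForm k (indicatorConstLp 2 hA hA' 1) (indicatorConstLp 2 hB hB' 1) =
      ∫ p in A ×ˢ B, k p := by
  rw [kernelForm, ← integral_indicator (hA.prod hB)]
  refine integral_congr_ae ?_
  filter_upwards [(Measure.quasiMeasurePreserving_fst (ν := volume)).ae
      (indicatorConstLp_coeFn (p := 2) (hs := hA) (hμs := hA') (c := (1 : ℂ))),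
    (Measure.quasiMeasurePreserving_snd (μ := volume)).ae
      (indicatorConstLp_coeFn (p := 2) (hs := hB) (hμs := hB') (c := (1 : ℂ)))] with p hpA hpB
  rw [hpA, hpB]
  by_cases hp : p.1 ∈ A <;> by_cases hp' : p.2 ∈ B <;> simp [hp, hp', Set.indicator, Set.mem_prod]

theorem ae_eq_of_kernelForm_eq {k k' : Plane d → ℂ} (hk : MemLp k 2) (hk' : MemLp k' 2)
    (h : ∀ g h : L2R d, kernelForm k g h = kernelForm k' g h) : k =ᵐ[volume] k' := by
  have hsub := ae_eq_zero_of_forall_setIntegral_finite_prod_eq_zero one_le_two (hk.sub hk')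
    fun A B hA hB hA' hB' => ?_
  · filter_upwards [hsub] with p hp using sub_eq_zero.1 hp
  have hAB : (volume : Measure (Plane d)) (A ×ˢ B) < ⊤ := by
    rw [Measure.volume_eq_prod, Measure.prod_prod]
    exact ENNReal.mul_lt_top hA' hB'
  have := isFiniteMeasure_restrict.2 hAB.ne
  refine (integral_sub (f := k) (g := k') ((hk.restrict _).integrable one_le_two)
    ((hk'.restrict _).integrable one_le_two)).trans (sub_eq_zero.2 ?_)
  have hind := h (indicatorConstLp 2 hA hA'.ne 1) (indicatorConstLp 2 hB hB'.ne 1)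
  rwa [kernelForm_indicatorConstLp, kernelForm_indicatorConstLp] at hind

theorem norm_conj_mul_translate_le (g h : L2R d) (x t : Fin d → ℝ) :
    ‖(starRingEnd ℂ) (g t) * h (t - x)‖ ≤ ‖g t‖ ^ 2 + ‖h (t - x)‖ ^ 2 := by
  rw [norm_mul, RCLike.norm_conj]
  nlinarith [sq_nonneg (‖g t‖ - ‖h (t - x)‖), sq_nonneg ‖g t‖, sq_nonneg ‖h (t - x)‖]

theorem integrable_conj_mul_translate (g h : L2R d) (x : Fin d → ℝ) :
    Integrable fun t => (starRingEnd ℂ) (g t) * h (t - x) := by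
  have mp := measurePreserving_sub_right (volume : Measure (Fin d → ℝ)) x
  exact ((Lp.memLp g).star).integrable_mul ((Lp.memLp h).comp_measurePreserving mp)

theorem integral_norm_conj_mul_translate_le (g h : L2R d) (x : Fin d → ℝ) :
    ∫ t, ‖(starRingEnd ℂ) (g t) * h (t - x)‖ ≤ (∫ t, ‖g t‖ ^ 2) + ∫ t, ‖h t‖ ^ 2 := by
  have hg := (memLp_two_iff_integrable_sq_norm (Lp.aestronglyMeasurable g)).1 (Lp.memLp g)
  have hh := (memLp_two_iff_integrable_sq_norm (Lp.aestronglyMeasurable h)).1 (Lp.memLp h)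
  have hh' : Integrable fun t => ‖h (t - x)‖ ^ 2 := hh.comp_sub_right x
  rw [← integral_sub_right_eq_self (fun t => ‖h t‖ ^ 2) x, ← integral_add hg hh']
  exact integral_mono (integrable_conj_mul_translate g h x).norm (hg.add hh')
    (norm_conj_mul_translate_le g h x)

section Fubini

variable {α : Type*} [MeasurableSpace α] {μ : Measure α}
  {F : α × (Fin d → ℝ) → ℂ} {c : (Fin d → ℝ) → α → ℂ}

theorem integrable_mul_unimodular_mul_translate (hF : Integrable F (μ.prod volume))
    (hc : Measurable (Function.uncurry c)) (hc1 : ∀ t v, ‖c t v‖ = 1) (g h : L2R d) :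
    Integrable (fun r : (α × (Fin d → ℝ)) × (Fin d → ℝ) =>
      F r.1 * (c r.2 r.1.1 * ((starRingEnd ℂ) (g r.2) * h (r.2 - r.1.2))))
      ((μ.prod volume).prod volume) := by
  have hm : AEStronglyMeasurable (fun r : (α × (Fin d → ℝ)) × (Fin d → ℝ) =>
      F r.1 * (c r.2 r.1.1 * ((starRingEnd ℂ) (g r.2) * h (r.2 - r.1.2))))
      ((μ.prod volume).prod volume) := by
    refine hF.1.comp_fst.mul (Measurable.aestronglyMeasurable (.mul ?_ (.mul ?_ ?_)))
    · exact hc.comp (measurable_snd.prodMk measurable_fst.fst)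
    · exact Complex.continuous_conj.measurable.comp
        ((Lp.stronglyMeasurable g).measurable.comp measurable_snd)
    · exact (Lp.stronglyMeasurable h).measurable.comp (by fun_prop)
  refine (integrable_prod_iff hm).2 ⟨.of_forall fun q => ?_, ?_⟩
  · have hcq : Measurable fun t => c t q.1 := hc.comp (measurable_id.prodMk measurable_const)
    exact (((integrable_conj_mul_translate g h q.2).bdd_mul (c := 1) hcq.aestronglyMeasurable
      (.of_forall fun t => (hc1 t q.1).le)).const_mul (F q) :)
  · refine (hF.norm.mul_const ((∫ t, ‖g t‖ ^ 2) + ∫ t, ‖h t‖ ^ 2)).mono'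
      hm.norm.integral_prod_right' (.of_forall fun q => ?_)
    simp only [norm_mul (F _), norm_mul (c _ _), hc1, one_mul]
    rw [integral_const_mul, Real.norm_of_nonneg (by positivity)]
    exact mul_le_mul_of_nonneg_left (integral_norm_conj_mul_translate_le g h q.2) (norm_nonneg _)

variable [SigmaFinite μ]

theorem measurePreserving_sub_snd_assoc :
    MeasurePreserving (fun r : Plane d × α => ((r.2, r.1.1 - r.1.2), r.1.1))
      ((volume : Measure (Plane d)).prod μ) ((μ.prod volume).prod volume) := by
  have h := (MeasurePreserving.id μ).prod
    ((Measure.measurePreserving_swap (μ := volume)).comp (measurePreserving_sub_snd (d := d)))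
  exact ((measurePreserving_prodAssoc μ volume volume).symm.comp h).comp
    Measure.measurePreserving_swap

theorem integral_mul_integral_eq_kernelForm (hF : Integrable F (μ.prod volume))
    (hc : Measurable (Function.uncurry c)) (hc1 : ∀ t v, ‖c t v‖ = 1) (g h : L2R d) :
    ∫ q, F q * (∫ t, c t q.1 * ((starRingEnd ℂ) (g t) * h (t - q.2))) ∂(μ.prod volume) =
      kernelForm (fun p => ∫ v, c p.1 v * F (v, p.1 - p.2) ∂μ) g h := by
  have hi := integrable_mul_unimodular_mul_translate hF hc hc1 g h
  have mp := measurePreserving_sub_snd_assoc (d := d) (μ := μ)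
  simp only [← integral_const_mul]
  rw [← integral_prod _ hi, ← integral_comp_of_measurePreserving mp hi.1]
  refine (integral_prod _ (mp.integrable_comp_of_integrable hi)).trans ?_
  refine integral_congr_ae (.of_forall fun p => ?_)
  simp only [← integral_mul_const, Function.comp_apply, sub_sub_cancel]
  exact integral_congr_ae (.of_forall fun v => by ring)

end Fubini

theorem coeFn_rep_assocChart [TwoStepLie 𝔫] (ℓ : Fin m → ℝ)
    (q : ((Fin m → ℝ) × (Fin d → ℝ)) × (Fin d → ℝ)) (h : L2R d) :
    e.rep ℓ (e.assocChart q) h =ᵐ[volume]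
      fun t => pairChar (e.freqMap (ℓ, t)) q.1 * h (t - q.2) := by
  filter_upwards [e.coeFn_rep ℓ (e.assocChart q) h] with t ht
  rw [ht, assocChart_apply, toCoords_ofCoords]
  simp only [pairChar, freqMap, phase, Matrix.mulVec_transpose, Matrix.dotProduct_mulVec]

theorem coeff_assocChart [TwoStepLie 𝔫] (ℓ : Fin m → ℝ) (g h : L2R d)
    (q : ((Fin m → ℝ) × (Fin d → ℝ)) × (Fin d → ℝ)) : e.coeff ℓ g h (e.assocChart q) =
      ∫ t, pairChar (e.freqMap (ℓ, t)) q.1 * ((starRingEnd ℂ) (g t) * h (t - q.2)) := by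
  rw [coeff, L2.inner_def]
  refine integral_congr_ae ?_
  filter_upwards [e.coeFn_rep_assocChart ℓ q h] with t ht
  rw [RCLike.inner_apply, ht]
  ring

end AdaptedBasis

/-! ### The Plancherel theorem -/

section IsometricGraph

variable {𝕜 E F : Type*} [RCLike 𝕜] [NormedAddCommGroup E] [InnerProductSpace 𝕜 E]
  [NormedAddCommGroup F] [InnerProductSpace 𝕜 F] {G : Submodule 𝕜 (E × F)}

theorem inner_snd_eq_inner_fst (hG : ∀ x ∈ G, ‖x.2‖ = ‖x.1‖) {x y : E × F} (hx : x ∈ G)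
    (hy : y ∈ G) : inner 𝕜 x.2 y.2 = inner 𝕜 x.1 y.1 := by
  have hI := G.smul_mem (RCLike.I : 𝕜) hy
  rw [inner_eq_sum_norm_sq_div_four, inner_eq_sum_norm_sq_div_four]
  exact congrArg (· / (4 : 𝕜)) <| by
    rw [← Prod.snd_add, ← Prod.snd_sub, ← Prod.smul_snd, ← Prod.snd_add, ← Prod.snd_sub,
      hG _ (add_mem hx hy), hG _ (sub_mem hx hy), hG _ (add_mem hx hI), hG _ (sub_mem hx hI)]
    rfl

theorem exists_mem_of_isClosed_of_norm_eq [CompleteSpace E] [CompleteSpace F]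
    (hc : IsClosed (G : Set (E × F))) (hG : ∀ x ∈ G, ‖x.2‖ = ‖x.1‖)
    (h0 : ∀ y : F, (∀ x ∈ G, inner 𝕜 x.2 y = 0) → y = 0) (y : F) : ∃ x, (x, y) ∈ G := by
  have hiso : Isometry fun x : G => x.1.2 := Isometry.of_dist_eq fun x y => by
    have h := hG _ (sub_mem x.2 y.2)
    rw [Subtype.dist_eq, dist_eq_norm, dist_eq_norm, Prod.norm_def, ← h, max_self, Prod.snd_sub]
  have : CompleteSpace G := hc.completeSpace_coe
  set R : Submodule 𝕜 F := G.map (LinearMap.snd 𝕜 E F)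
  have hR : (R : Set F) = Set.range fun x : G => x.1.2 := by
    ext z
    simp [R]
  have : CompleteSpace R := (hR ▸ hiso.isClosedEmbedding.isClosed_range).completeSpace_coe
  have hbot : Rᗮ = ⊥ := (Submodule.eq_bot_iff _).2 fun z hz =>
    h0 z fun x hx => hz x.2 (Submodule.mem_map_of_mem hx)
  obtain ⟨x, hx, rfl⟩ : y ∈ R := Submodule.orthogonal_eq_bot_iff.1 hbot ▸ Submodule.mem_top
  exact ⟨x.1, hx⟩

end IsometricGraph

namespace AdaptedBasis

variable {𝔫 : Type*} [LieRing 𝔫] [LieAlgebra ℝ 𝔫] {m d : ℕ} (e : AdaptedBasis 𝔫 m d)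
  [TwoStepLie 𝔫]

/-- The field of integral kernels of the operators `∫_N f(n) π_ℓ(n) dn`. -/
def fourierKernel (f : NilGroup 𝔫 → ℂ) (p : (Fin m → ℝ) × Plane d) : ℂ :=
  partialFourier (f ∘ e.assocChart) (e.kernelMap p)

theorem kernelForm_fourierKernel {f : NilGroup 𝔫 → ℂ} (hf : Integrable f e.haar)
    (ℓ : Fin m → ℝ) (g h : L2R d) :
    kernelForm (fun p => e.fourierKernel f (ℓ, p)) g h =
      ∫ n, f n * e.coeff ℓ g h n ∂e.haar := by
  have hc : Measurable (Function.uncurry fun t v => pairChar (e.freqMap (ℓ, t)) v) :=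
    measurable_pairChar (e.measurable_freqMap.comp (measurable_const.prodMk measurable_fst))
      measurable_snd
  refine (integral_mul_integral_eq_kernelForm
    (e.measurePreserving_assocChart.integrable_comp_of_integrable hf) hc
    (fun t v => norm_pairChar _ _) g h).symm.trans ?_
  rw [← e.measurePreserving_assocChart.integral_comp' fun n => f n * e.coeff ℓ g h n]
  simp only [coeff_assocChart]
  rfl

theorem isFourierKernel_iff {f : NilGroup 𝔫 → ℂ} (hf : Integrable f e.haar) {ℓ : Fin m → ℝ}
    (hℓ : MemLp (fun p => e.fourierKernel f (ℓ, p)) 2) (k : Plane d → ℂ) :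
    e.IsFourierKernel f ℓ k ↔ k =ᵐ[volume] fun p => e.fourierKernel f (ℓ, p) := by
  refine ⟨fun hk => ae_eq_of_kernelForm_eq hk.1 hℓ fun g h =>
    (hk.2 g h).trans (e.kernelForm_fourierKernel hf ℓ g h).symm,
    fun hk => ⟨hℓ.ae_eq hk.symm, fun g h => ?_⟩⟩
  rw [← e.kernelForm_fourierKernel hf ℓ g h]
  refine integral_congr_ae ?_
  filter_upwards [hk] with p hp
  rw [hp]

theorem memLp_partialFourier_comp_assocChart {f : NilGroup 𝔫 → ℂ} (h1 : Integrable f e.haar)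
    (h2 : MemLp f 2 e.haar) : MemLp (partialFourier (f ∘ e.assocChart)) 2 :=
  memLp_partialFourier (e.measurePreserving_assocChart.integrable_comp_of_integrable h1)
    (h2.comp_measurePreserving e.measurePreserving_assocChart)

theorem memLp_fourierKernel {f : NilGroup 𝔫 → ℂ} (h1 : Integrable f e.haar)
    (h2 : MemLp f 2 e.haar) : MemLp (e.fourierKernel f) 2 (e.plancherelMeasure.prod volume) :=
  (e.memLp_partialFourier_comp_assocChart h1 h2).comp_measurePreserving
    e.measurePreserving_kernelMap

theorem eLpNorm_fourierKernel {f : NilGroup 𝔫 → ℂ} (h1 : Integrable f e.haar)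
    (h2 : MemLp f 2 e.haar) :
    eLpNorm (e.fourierKernel f) 2 (e.plancherelMeasure.prod volume) = eLpNorm f 2 e.haar := by
  have mp := e.measurePreserving_assocChart
  have h := lintegral_partialFourier_enorm_sq (mp.integrable_comp_of_integrable h1)
    (h2.comp_measurePreserving mp)
  rw [lintegral_enorm_sq, lintegral_enorm_sq, ← Measure.volume_eq_prod,
    eLpNorm_comp_measurePreserving h2.1 mp] at h
  exact (eLpNorm_comp_measurePreserving (e.memLp_partialFourier_comp_assocChart h1 h2).1
    e.measurePreserving_kernelMap).trans ((ENNReal.pow_right_strictMono two_ne_zero).injective h)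

theorem mem_fourierGraph_iff (f : e.L2N) (K : e.L2Sigma) : (f, K) ∈ e.fourierGraph ↔
    Integrable f e.haar ∧ K =ᵐ[e.plancherelMeasure.prod volume] e.fourierKernel f := by
  refine and_congr_right fun hf => ?_
  have hk := e.memLp_fourierKernel hf (Lp.memLp f)
  rw [ae_eq_prod_iff_ae_ae_eq (Lp.aestronglyMeasurable K) hk.1]
  refine Filter.eventually_congr ?_
  filter_upwards [ae_memLp_prodMk_left two_ne_zero ENNReal.ofNat_ne_top hk] with ℓ hℓ
    using e.isFourierKernel_iff hf hℓ _

theorem norm_eq_of_mem_fourierGraph {x : e.L2N × e.L2Sigma} (h : x ∈ e.fourierGraph) :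
    ‖x.2‖ = ‖x.1‖ := by
  obtain ⟨hf, hK⟩ := (e.mem_fourierGraph_iff x.1 x.2).1 h
  rw [Lp.norm_def, Lp.norm_def, eLpNorm_congr_ae hK, e.eLpNorm_fourierKernel hf (Lp.memLp _)]

theorem norm_eq_of_mem_plancherelGraph {x : e.L2N × e.L2Sigma} (h : x ∈ e.plancherelGraph) :
    ‖x.2‖ = ‖x.1‖ :=
  closure_minimal (fun _ hy => e.norm_eq_of_mem_fourierGraph hy)
    (isClosed_eq continuous_snd.norm continuous_fst.norm) h

theorem inner_eq_of_mem_plancherelGraph {x y : e.L2N × e.L2Sigma} (hx : x ∈ e.plancherelGraph)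
    (hy : y ∈ e.plancherelGraph) : inner ℂ x.2 y.2 = inner ℂ x.1 y.1 :=
  inner_snd_eq_inner_fst (fun _ hz => e.norm_eq_of_mem_plancherelGraph hz) hx hy

theorem exists_mem_fourierGraph {F : ((Fin m → ℝ) × (Fin d → ℝ)) × (Fin d → ℝ) → ℂ}
    (h1 : Integrable F) (h2 : MemLp F 2) : ∃ x ∈ e.fourierGraph,
      x.2 =ᵐ[e.plancherelMeasure.prod volume] fun p => partialFourier F (e.kernelMap p) := by
  have mp := e.measurePreserving_assocChart.symm e.assocChart
  have hf1 : Integrable (F ∘ e.assocChart.symm) e.haar := mp.integrable_comp_of_integrable h1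
  have hf2 : MemLp (F ∘ e.assocChart.symm) 2 e.haar := h2.comp_measurePreserving mp
  have hf := hf1.congr hf2.coeFn_toLp.symm
  have hk := e.memLp_fourierKernel hf (Lp.memLp _)
  refine ⟨(hf2.toLp _, hk.toLp _), (e.mem_fourierGraph_iff _ _).2 ⟨hf, hk.coeFn_toLp⟩, ?_⟩
  have hF : (hf2.toLp _ : NilGroup 𝔫 → ℂ) ∘ e.assocChart =ᵐ[volume] F := by
    filter_upwards [e.measurePreserving_assocChart.quasiMeasurePreserving.ae hf2.coeFn_toLp]
      with q hq
    rw [Function.comp_apply, hq, Function.comp_apply, MeasurableEquiv.symm_apply_apply]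
  exact hk.coeFn_toLp.trans
    (e.measurePreserving_kernelMap.quasiMeasurePreserving.ae (partialFourier_congr_ae hF))

theorem eq_zero_of_forall_mem_fourierGraph_inner_eq_zero {K : e.L2Sigma}
    (hK : ∀ x ∈ e.fourierGraph, inner ℂ x.2 K = 0) : K = 0 := by
  set h : ((Fin m → ℝ) × (Fin d → ℝ)) × (Fin d → ℝ) → ℂ :=
    fun q => (starRingEnd ℂ) (K (e.kernelInv q))
  have hh : MemLp h 2 := ((Lp.memLp K).comp_measurePreserving e.measurePreserving_kernelInv).star
  have hhK : ∀ᵐ p ∂(e.plancherelMeasure.prod volume),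
      h (e.kernelMap p) = (starRingEnd ℂ) (K p) := by
    filter_upwards [e.ae_plancherelMeasure_prod_mem_crossSection volume] with p hp
    simp only [h, e.kernelInv_kernelMap hp]
  have h0 : h =ᵐ[volume] 0 := by
    refine ae_eq_zero_of_forall_integral_partialFourier_mul_eq_zero hh fun F hF1 hF2 => ?_
    obtain ⟨x, hx, hxF⟩ := e.exists_mem_fourierGraph hF1 hF2
    have hz := congrArg (starRingEnd ℂ) (hK x hx)
    rw [inner_conj_symm, L2.inner_def, map_zero] at hz
    refine (integral_comp_of_measurePreserving e.measurePreserving_kernelMap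
      ((memLp_partialFourier hF1 hF2).1.mul hh.1)).symm.trans (Eq.trans ?_ hz)
    refine integral_congr_ae ?_
    filter_upwards [hxF, hhK] with p hp hp'
    rw [RCLike.inner_apply, Pi.mul_apply, hp, hp']
  rw [Lp.eq_zero_iff_ae_eq_zero]
  filter_upwards [hhK, e.measurePreserving_kernelMap.quasiMeasurePreserving.ae h0] with p h1 h2
  rwa [h1, Pi.zero_apply, map_eq_zero] at h2

theorem exists_mem_plancherelGraph (K : e.L2Sigma) : ∃ f, (f, K) ∈ e.plancherelGraph :=
  exists_mem_of_isClosed_of_norm_eq (Submodule.isClosed_topologicalClosure _)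
    (fun _ hx => e.norm_eq_of_mem_plancherelGraph hx)
    (fun _ hK => e.eq_zero_of_forall_mem_fourierGraph_inner_eq_zero fun x hx =>
      hK x (Submodule.le_topologicalClosure _ hx)) K

end AdaptedBasis

/-! ### The Plancherel transform intertwines `L` and `⊕ π_ℓ ⊗ 1` -/

theorem measurePreserving_shear {G α β : Type*} [AddGroup G] [MeasurableSpace G] [MeasurableAdd₂ G]
    [MeasurableSpace α] [MeasurableSpace β] {ρ : Measure G} [ρ.IsAddRightInvariant] [SFinite ρ]
    {μ : Measure α} {ν : Measure β} [SFinite μ] [SFinite ν] {T : α → β}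
    (hT : MeasurePreserving T μ ν) {f : α → G} (hf : Measurable f) :
    MeasurePreserving (fun p : G × α => (p.1 + f p.2, T p.2)) (ρ.prod μ) (ρ.prod ν) :=
  (Measure.measurePreserving_swap.comp
    (hT.skew_product (g := fun r z => z + f r) (measurable_snd.add (hf.comp measurable_fst))
      (.of_forall fun r => (measurePreserving_add_right ρ (f r)).map_eq))).comp
    Measure.measurePreserving_swap

section WeightedComp

variable {α β 𝕜 : Type*} [MeasurableSpace α] [MeasurableSpace β] {μ : Measure α} {ν : Measure β}
  [RCLike 𝕜] {p : ℝ≥0∞} {c : α → 𝕜} {T : α → β}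

theorem eLpNorm_mul_comp (hc1 : ∀ x, ‖c x‖ = 1) (hT : MeasurePreserving T μ ν) {f : β → 𝕜}
    (hf : AEStronglyMeasurable f ν) : eLpNorm (fun x => c x * f (T x)) p μ = eLpNorm f p ν := by
  rw [← eLpNorm_comp_measurePreserving hf hT]
  exact eLpNorm_congr_norm_ae (.of_forall fun x => by rw [norm_mul, hc1, one_mul]; rfl)

theorem memLp_mul_comp (hc : AEStronglyMeasurable c μ) (hc1 : ∀ x, ‖c x‖ = 1)
    (hT : MeasurePreserving T μ ν) {f : β → 𝕜} (hf : MemLp f p ν) :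
    MemLp (fun x => c x * f (T x)) p μ :=
  ⟨hc.mul (hf.1.comp_measurePreserving hT), by rw [eLpNorm_mul_comp hc1 hT hf.1]; exact hf.2⟩

/-- The weighted composition operator `F ↦ c · (F ∘ T)`, which is isometric for a unimodular
weight `c` and a measure preserving map `T`. -/
def weightedComp [Fact (1 ≤ p)] (hc : AEStronglyMeasurable c μ) (hc1 : ∀ x, ‖c x‖ = 1)
    (hT : MeasurePreserving T μ ν) : Lp 𝕜 p ν →ₗᵢ[𝕜] Lp 𝕜 p μ where
  toFun F := (memLp_mul_comp hc hc1 hT (Lp.memLp F)).toLp _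
  map_add' F G := by
    rw [← MemLp.toLp_add]
    refine MemLp.toLp_congr _ _ ?_
    filter_upwards [hT.quasiMeasurePreserving.ae (Lp.coeFn_add F G)] with x hx
    rw [hx, Pi.add_apply, Pi.add_apply, mul_add]
  map_smul' a F := by
    rw [RingHom.id_apply, ← MemLp.toLp_const_smul]
    refine MemLp.toLp_congr _ _ ?_
    filter_upwards [hT.quasiMeasurePreserving.ae (Lp.coeFn_smul a F)] with x hx
    rw [hx, Pi.smul_apply, Pi.smul_apply, smul_eq_mul, smul_eq_mul, mul_left_comm]
  norm_map' F := by
    change ‖(memLp_mul_comp hc hc1 hT (Lp.memLp F)).toLp _‖ = ‖F‖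
    rw [Lp.norm_toLp, eLpNorm_mul_comp hc1 hT (Lp.aestronglyMeasurable F), Lp.norm_def]

theorem coeFn_weightedComp [Fact (1 ≤ p)] (hc : AEStronglyMeasurable c μ) (hc1 : ∀ x, ‖c x‖ = 1)
    (hT : MeasurePreserving T μ ν) (F : Lp 𝕜 p ν) :
    weightedComp hc hc1 hT F =ᵐ[μ] fun x => c x * F (T x) :=
  (memLp_mul_comp hc hc1 hT (Lp.memLp F)).coeFn_toLp

end WeightedComp

namespace AdaptedBasis

variable {𝔫 : Type*} [LieRing 𝔫] [LieAlgebra ℝ 𝔫] {m d : ℕ} (e : AdaptedBasis 𝔫 m d)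

theorem measurable_zRepr_lie :
    Measurable fun p : (Fin d → ℝ) × (Fin d → ℝ) => e.zRepr ⁅e.xVec p.1, e.yVec p.2⁆ := by
  refine measurable_pi_lambda _ fun k => ?_
  simp only [zRepr, xVec, yVec, lie_sum, lie_smul, sum_lie, smul_lie, map_sum, map_smul,
    Finsupp.coe_finsetSum, Finset.sum_apply, Finsupp.smul_apply, smul_eq_mul]
  fun_prop

theorem dotProduct_zRepr_lie (ℓ : Fin m → ℝ) (x y : Fin d → ℝ) :
    ℓ ⬝ᵥ e.zRepr ⁅e.xVec x, e.yVec y⁆ = -(x ⬝ᵥ (e.matrixB ℓ *ᵥ y)) := by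
  rw [← functional_apply]
  simp only [xVec, yVec, sum_lie, lie_sum, smul_lie, lie_smul, map_sum, map_smul, smul_eq_mul,
    dotProduct, mulVec, matrixB, Matrix.of_apply, Finset.mul_sum, neg_mul, mul_neg,
    Finset.sum_neg_distrib, neg_neg]
  rw [Finset.sum_comm]
  exact Finset.sum_congr rfl fun i _ => Finset.sum_congr rfl fun j _ => by ring

/-- The action of left translation by the point with coordinates `q = ((z, y), x)` on the
coordinates `(z, y)`. -/
def shiftEquiv (q : ((Fin m → ℝ) × (Fin d → ℝ)) × (Fin d → ℝ)) :
    ((Fin m → ℝ) × (Fin d → ℝ)) ≃ᵐ ((Fin m → ℝ) × (Fin d → ℝ)) where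
  toFun v := (v.1 + (q.1.1 + e.zRepr ⁅e.xVec q.2, e.yVec v.2⁆), v.2 + q.1.2)
  invFun v := (v.1 - (q.1.1 + e.zRepr ⁅e.xVec q.2, e.yVec (v.2 - q.1.2)⁆), v.2 - q.1.2)
  left_inv v := by simp
  right_inv v := by simp
  measurable_toFun := by
    have := e.measurable_zRepr_lie.comp (measurable_prodMk_left (x := q.2))
    exact (measurable_fst.add ((this.comp measurable_snd).const_add _)).prodMk
      (measurable_snd.add_const _)
  measurable_invFun := by
    have := e.measurable_zRepr_lie.comp (measurable_prodMk_left (x := q.2))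
    exact (measurable_fst.sub ((this.comp (measurable_snd.sub_const _)).const_add _)).prodMk
      (measurable_snd.sub_const _)

theorem measurePreserving_shiftEquiv (q : ((Fin m → ℝ) × (Fin d → ℝ)) × (Fin d → ℝ)) :
    MeasurePreserving (e.shiftEquiv q) volume volume :=
  measurePreserving_shear (measurePreserving_add_right volume q.1.2)
    ((e.measurable_zRepr_lie.comp measurable_prodMk_left).const_add q.1.1)

theorem pairChar_shiftEquiv (q : ((Fin m → ℝ) × (Fin d → ℝ)) × (Fin d → ℝ)) (ℓ : Fin m → ℝ)
    (t : Fin d → ℝ) (v : (Fin m → ℝ) × (Fin d → ℝ)) :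
    pairChar (e.freqMap (ℓ, t)) (e.shiftEquiv q v) =
      pairChar (e.freqMap (ℓ, t)) q.1 * pairChar (e.freqMap (ℓ, t - q.2)) v := by
  simp only [pairChar, freqMap, shiftEquiv, MeasurableEquiv.coe_mk, Equiv.coe_fn_mk,
    Matrix.mulVec_transpose, ← Matrix.dotProduct_mulVec]
  rw [← Complex.exp_add, ← mul_add, ← Complex.ofReal_add]
  congr 3
  simp only [dotProduct_add, dotProduct_zRepr_lie, Matrix.mulVec_add, sub_dotProduct]
  ring

theorem partialFourier_shift (q : ((Fin m → ℝ) × (Fin d → ℝ)) × (Fin d → ℝ))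
    (F : ((Fin m → ℝ) × (Fin d → ℝ)) × (Fin d → ℝ) → ℂ) (p : (Fin m → ℝ) × Plane d) :
    partialFourier (fun r => F ((e.shiftEquiv q).symm r.1, r.2 - q.2)) (e.kernelMap p) =
      pairChar (e.freqMap (p.1, p.2.1)) q.1 *
        partialFourier F (e.kernelMap (p.1, (p.2.1 - q.2, p.2.2))) := by
  simp only [partialFourier, charIntegral, kernelMap]
  rw [← (e.measurePreserving_shiftEquiv q).integral_comp', ← integral_const_mul]
  refine integral_congr_ae (.of_forall fun v => ?_)
  simp only [pairChar_shiftEquiv, MeasurableEquiv.symm_apply_apply, mul_assoc,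
    sub_right_comm p.2.1 p.2.2]

theorem measurePreserving_kernelShift (x : Fin d → ℝ) :
    MeasurePreserving (fun p : (Fin m → ℝ) × Plane d => (p.1, (p.2.1 - x, p.2.2)))
      (e.plancherelMeasure.prod volume) (e.plancherelMeasure.prod volume) :=
  (MeasurePreserving.id _).prod ((measurePreserving_sub_right volume x).prod (.id _))

theorem measurable_pairChar_freqMap (v : (Fin m → ℝ) × (Fin d → ℝ)) :
    Measurable fun p : (Fin m → ℝ) × Plane d => pairChar (e.freqMap (p.1, p.2.1)) v :=
  measurable_pairChar
    (e.measurable_freqMap.comp (measurable_fst.prodMk measurable_snd.fst)) measurable_const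

/-- The action `K(ℓ) ↦ π_ℓ(n) K(ℓ)` on fields of Hilbert-Schmidt operators, in terms of integral
kernels and the coordinates `q = ((z, y), x)` of `n`. -/
def kernelAction (q : ((Fin m → ℝ) × (Fin d → ℝ)) × (Fin d → ℝ)) : e.L2Sigma →ₗᵢ[ℂ] e.L2Sigma :=
  weightedComp (e.measurable_pairChar_freqMap q.1).aestronglyMeasurable
    (fun _ => norm_pairChar _ _) (e.measurePreserving_kernelShift q.2)

theorem coeFn_kernelAction (q : ((Fin m → ℝ) × (Fin d → ℝ)) × (Fin d → ℝ)) (K : e.L2Sigma) :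
    e.kernelAction q K =ᵐ[e.plancherelMeasure.prod volume] fun p =>
      pairChar (e.freqMap (p.1, p.2.1)) q.1 * K (p.1, (p.2.1 - q.2, p.2.2)) :=
  coeFn_weightedComp _ _ _ K

variable [TwoStepLie 𝔫]

theorem kernelAction_mem_rankOneField (q : ((Fin m → ℝ) × (Fin d → ℝ)) × (Fin d → ℝ))
    {I : Set (Fin m → ℝ)} {u : L2R d} {K : e.L2Sigma} (hK : K ∈ e.rankOneField I u) :
    e.kernelAction q K ∈ e.rankOneField I u := by
  have mp : MeasurePreserving (fun p : Plane d => (p.1 - q.2, p.2)) volume volume :=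
    (measurePreserving_sub_right volume q.2).prod (.id _)
  change ∀ᵐ ℓ ∂e.plancherelMeasure, _ at hK ⊢
  filter_upwards [hK, Measure.ae_ae_of_ae_prod (e.coeFn_kernelAction q K)] with ℓ hℓ hact
  refine ⟨fun hI => ?_, fun hI => ?_⟩
  · obtain ⟨v, hv⟩ := hℓ.1 hI
    refine ⟨e.rep ℓ (e.assocChart q) v, ?_⟩
    filter_upwards [hact, mp.quasiMeasurePreserving.ae hv,
      (Measure.quasiMeasurePreserving_fst (ν := volume)).ae (e.coeFn_rep_assocChart ℓ q v)]
      with p hp hvp hrep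
    rw [hp, hvp, hrep, mul_assoc]
  · filter_upwards [hact, mp.quasiMeasurePreserving.ae (hℓ.2 hI)] with p hp h0
    rw [hp, h0, mul_zero]

theorem assocChart_mul_assocChart (q r : ((Fin m → ℝ) × (Fin d → ℝ)) × (Fin d → ℝ)) :
    e.assocChart q * e.assocChart r = e.assocChart (e.shiftEquiv q r.1, r.2 + q.2) :=
  e.ofCoords_mul (q.1.1, q.1.2, q.2) (r.1.1, r.1.2, r.2)

theorem inv_assocChart_mul_assocChart (q r : ((Fin m → ℝ) × (Fin d → ℝ)) × (Fin d → ℝ)) :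
    (e.assocChart q)⁻¹ * e.assocChart r =
      e.assocChart ((e.shiftEquiv q).symm r.1, r.2 - q.2) := by
  rw [inv_mul_eq_iff_eq_mul, assocChart_mul_assocChart, MeasurableEquiv.apply_symm_apply,
    sub_add_cancel]

theorem coeFn_leftRegular (n : NilGroup 𝔫) (f : e.L2N) :
    e.leftRegular n f =ᵐ[e.haar] fun n' => f (n⁻¹ * n') :=
  Lp.coeFn_compMeasurePreserving f (e.measurePreserving_mul_left n⁻¹)

theorem leftRegular_mem_fourierGraph (q : ((Fin m → ℝ) × (Fin d → ℝ)) × (Fin d → ℝ))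
    {x : e.L2N × e.L2Sigma} (h : x ∈ e.fourierGraph) :
    (e.leftRegular (e.assocChart q) x.1, e.kernelAction q x.2) ∈ e.fourierGraph := by
  obtain ⟨hint, hK⟩ := (e.mem_fourierGraph_iff x.1 x.2).1 h
  have hL := e.coeFn_leftRegular (e.assocChart q) x.1
  have hF : (e.leftRegular (e.assocChart q) x.1 : NilGroup 𝔫 → ℂ) ∘ e.assocChart =ᵐ[volume]
      fun r => (x.1 ∘ e.assocChart) ((e.shiftEquiv q).symm r.1, r.2 - q.2) := by
    filter_upwards [e.measurePreserving_assocChart.quasiMeasurePreserving.ae hL] with r hr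
    rw [Function.comp_apply, hr, inv_assocChart_mul_assocChart, Function.comp_apply]
  refine (e.mem_fourierGraph_iff _ _).2 ⟨((e.measurePreserving_mul_left
    (e.assocChart q)⁻¹).integrable_comp_of_integrable hint).congr hL.symm, ?_⟩
  filter_upwards [e.coeFn_kernelAction q x.2,
    (e.measurePreserving_kernelShift q.2).quasiMeasurePreserving.ae hK,
    e.measurePreserving_kernelMap.quasiMeasurePreserving.ae (partialFourier_congr_ae hF)]
    with p hact hKp hFp
  rw [hact, hKp, fourierKernel, fourierKernel, hFp, partialFourier_shift]

theorem leftRegular_mem_plancherelGraph (q : ((Fin m → ℝ) × (Fin d → ℝ)) × (Fin d → ℝ))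
    {x : e.L2N × e.L2Sigma} (h : x ∈ e.plancherelGraph) :
    (e.leftRegular (e.assocChart q) x.1, e.kernelAction q x.2) ∈ e.plancherelGraph := by
  have hcont : Continuous fun y : e.L2N × e.L2Sigma =>
      (e.leftRegular (e.assocChart q) y.1, e.kernelAction q y.2) :=
    ((e.leftRegular _).continuous.comp continuous_fst).prodMk
      ((e.kernelAction q).continuous.comp continuous_snd)
  have hmaps : Set.MapsTo (fun y : e.L2N × e.L2Sigma =>
      (e.leftRegular (e.assocChart q) y.1, e.kernelAction q y.2)) e.fourierGraph e.fourierGraph :=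
    fun _ => e.leftRegular_mem_fourierGraph q
  exact hmaps.closure hcont h

theorem leftRegular_mem_bandLimitedSpace (n : NilGroup 𝔫) {I : Set (Fin m → ℝ)} {u : L2R d}
    {f : e.L2N} (hf : f ∈ e.bandLimitedSpace I u) :
    e.leftRegular n f ∈ e.bandLimitedSpace I u := by
  obtain ⟨x, ⟨hx, hxI⟩, rfl⟩ := hf
  have h := e.leftRegular_mem_plancherelGraph (e.assocChart.symm n) hx
  rw [MeasurableEquiv.apply_symm_apply] at h
  exact ⟨_, ⟨h, e.kernelAction_mem_rankOneField _ hxI⟩, rfl⟩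

/-- The left regular representation as a homomorphism into the isometries of `L²(N)`. -/
def leftRegularHom : NilGroup 𝔫 →* (e.L2N →ₗᵢ[ℂ] e.L2N) where
  toFun := e.leftRegular
  map_one' := by
    ext1 f
    refine Lp.ext ?_
    filter_upwards [e.coeFn_leftRegular 1 f] with n hn
    rw [hn, inv_one, one_mul]
    rfl
  map_mul' n n' := by
    ext1 f
    refine Lp.ext ?_
    filter_upwards [e.coeFn_leftRegular (n * n') f, e.coeFn_leftRegular n (e.leftRegular n' f),
      (e.measurePreserving_mul_left n⁻¹).quasiMeasurePreserving.ae (e.coeFn_leftRegular n' f)]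
      with p hmul hn hn'
    rw [hmul, LinearIsometry.coe_mul, Function.comp_apply, hn, hn', _root_.mul_inv_rev, mul_assoc]

end AdaptedBasis

/-! ### Square integrable matrix coefficients -/

section Kernel

variable {α β 𝕜 : Type*} [MeasurableSpace α] [MeasurableSpace β] [RCLike 𝕜] {μ : Measure α}
  {ν : Measure β}

theorem enorm_sq_integral_mul_le {f g : α → 𝕜} (hf : AEStronglyMeasurable f μ)
    (hg : AEStronglyMeasurable g μ) :
    ‖∫ x, f x * g x ∂μ‖ₑ ^ 2 ≤ (∫⁻ x, ‖f x‖ₑ ^ 2 ∂μ) * ∫⁻ x, ‖g x‖ₑ ^ 2 ∂μ := by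
  have hle : ‖∫ x, f x * g x ∂μ‖ₑ ≤ ∫⁻ x, ‖f x‖ₑ * ‖g x‖ₑ ∂μ :=
    (enorm_integral_le_lintegral_enorm _).trans_eq (by simp only [enorm_mul])
  have hHolder :=
    ENNReal.lintegral_mul_le_Lp_mul_Lq μ Real.HolderConjugate.two_two hf.enorm hg.enorm
  refine (pow_le_pow_left₀ zero_le (hle.trans hHolder) 2).trans_eq ?_
  rw [mul_pow, ← ENNReal.rpow_natCast, ← ENNReal.rpow_natCast, ← ENNReal.rpow_mul,
    ← ENNReal.rpow_mul]
  norm_num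

theorem lintegral_enorm_sq_integral_mul_le [SFinite ν] {k : α × β → 𝕜} (hk : Measurable k)
    {u : β → 𝕜} (hu : AEStronglyMeasurable u ν) :
    ∫⁻ x, ‖∫ y, k (x, y) * u y ∂ν‖ₑ ^ 2 ∂μ ≤
      (∫⁻ p, ‖k p‖ₑ ^ 2 ∂(μ.prod ν)) * ∫⁻ y, ‖u y‖ₑ ^ 2 ∂ν := by
  have hk2 : Measurable fun p => ‖k p‖ₑ ^ 2 := hk.enorm.pow_const 2
  rw [lintegral_prod _ hk2.aemeasurable, ← lintegral_mul_const _ hk2.lintegral_prod_right']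
  exact lintegral_mono fun x =>
    enorm_sq_integral_mul_le (hk.comp measurable_prodMk_left).aestronglyMeasurable hu

theorem lintegral_prod_mul_comp_sub {G : Type*} [AddGroup G] [MeasurableSpace G]
    [MeasurableAdd₂ G] [MeasurableNeg G] {ρ : Measure G} [SFinite ρ] [ρ.IsAddLeftInvariant]
    [ρ.IsNegInvariant] [SFinite μ] {f : G → ℝ≥0∞} {g : α × G → ℝ≥0∞} (hf : Measurable f)
    (hg : Measurable g) :
    ∫⁻ p, f p.1.2 * g (p.1.1, p.1.2 - p.2) ∂((μ.prod ρ).prod ρ) =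
      (∫⁻ t, f t ∂ρ) * ∫⁻ p, g p ∂(μ.prod ρ) := by
  have : ∀ x, Measurable fun s => g (x, s) := fun x => hg.comp measurable_prodMk_left
  have hinner : ∀ r : α × G,
      ∫⁻ s, f r.2 * g (r.1, r.2 - s) ∂ρ = f r.2 * ∫⁻ s, g (r.1, s) ∂ρ := fun r => by
    rw [lintegral_const_mul _ (by fun_prop),
      lintegral_sub_left_eq_self (fun s => g (r.1, s)) r.2]
  rw [lintegral_prod _ (by fun_prop), lintegral_congr hinner, lintegral_prod _ hg.aemeasurable,
    mul_comm, ← lintegral_prod_mul hg.lintegral_prod_right'.aemeasurable hf.aemeasurable]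
  simp only [mul_comm]

end Kernel

theorem measurePreserving_prodAssoc_plane {α : Type*} [MeasurableSpace α] {d : ℕ} (μ : Measure α)
    [SFinite μ] : MeasurePreserving MeasurableEquiv.prodAssoc
      ((μ.prod (volume : Measure (Fin d → ℝ))).prod (volume : Measure (Fin d → ℝ)))
      (μ.prod (volume : Measure (AdaptedBasis.Plane d))) := by
  rw [Measure.volume_eq_prod]
  exact measurePreserving_prodAssoc μ volume volume

theorem pairChar_comm {ι κ : Type*} [Fintype ι] [Fintype κ] (w p : (ι → ℝ) × (κ → ℝ)) :
    pairChar w p = pairChar p w := by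
  rw [pairChar, pairChar, dotProduct_comm w.1, dotProduct_comm w.2]

namespace AdaptedBasis

variable {𝔫 : Type*} [LieRing 𝔫] [LieAlgebra ℝ 𝔫] {m d : ℕ} (e : AdaptedBasis 𝔫 m d)
  {I : Set (Fin m → ℝ)} (hI : MeasurableSet I) (hI' : e.plancherelMeasure I ≠ ⊤) (u : L2R d)
  (K : e.L2Sigma)

/-- The field of operators `1_I(ℓ) u ⊗ u`, in terms of integral kernels. -/
def selfTensorField : e.L2Sigma :=
  (memLp_two_mul_prod (memLp_indicator_const 2 hI (1 : ℂ) (.inr hI'))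
    (memLp_two_mul_prod (Lp.memLp u) (Lp.memLp u).star)).toLp _

theorem coeFn_selfTensorField : e.selfTensorField hI hI' u =ᵐ[e.plancherelMeasure.prod volume]
    fun p => I.indicator (fun _ => 1) p.1 * (u p.2.1 * (starRingEnd ℂ) (u p.2.2)) :=
  MemLp.coeFn_toLp _

theorem selfTensorField_mem_rankOneField {J : Set (Fin m → ℝ)} (hIJ : I ⊆ J) :
    e.selfTensorField hI hI' u ∈ e.rankOneField J u := by
  change ∀ᵐ ℓ ∂e.plancherelMeasure, _
  filter_upwards [Measure.ae_ae_of_ae_prod (e.coeFn_selfTensorField hI hI' u)] with ℓ hℓ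
  refine ⟨fun _ => ⟨I.indicator (fun _ => (1 : ℂ)) ℓ • u, ?_⟩, fun hJ => ?_⟩
  · filter_upwards [hℓ, (Measure.quasiMeasurePreserving_fst (ν := volume)).ae
      (Lp.coeFn_smul (I.indicator (fun _ => (1 : ℂ)) ℓ) u)] with p hp hsmul
    rw [hp, hsmul, Pi.smul_apply, smul_eq_mul, mul_assoc]
  · filter_upwards [hℓ] with p hp
    rw [hp, Set.indicator_of_notMem fun h => hJ (hIJ h), zero_mul]

theorem enorm_sq_selfTensorField :
    ‖e.selfTensorField hI hI' u‖ₑ ^ 2 = e.plancherelMeasure I * (‖u‖ₑ ^ 2 * ‖u‖ₑ ^ 2) := by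
  have hu := Lp.aestronglyMeasurable u
  have hu2 : AEStronglyMeasurable (fun p : Plane d => u p.1 * (starRingEnd ℂ) (u p.2)) volume :=
    hu.comp_fst.mul hu.star.comp_snd
  have huu : ∫⁻ p : Plane d, ‖u p.1 * (starRingEnd ℂ) (u p.2)‖ₑ ^ 2 = ‖u‖ₑ ^ 2 * ‖u‖ₑ ^ 2 := by
    rw [Lp_enorm_sq, Measure.volume_eq_prod]
    refine (lintegral_enorm_sq_mul_prod hu hu.star).trans ?_
    simp only [Pi.star_apply, ← starRingEnd_apply, RCLike.enorm_conj]
  have hind : ∫⁻ ℓ, ‖I.indicator (fun _ => (1 : ℂ)) ℓ‖ₑ ^ 2 ∂e.plancherelMeasure =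
      e.plancherelMeasure I := by
    rw [← lintegral_indicator_one hI]
    exact lintegral_congr fun ℓ => by by_cases hℓ : ℓ ∈ I <;> simp [hℓ]
  have hcoe := (e.coeFn_selfTensorField hI hI' u).fun_comp fun z => ‖z‖ₑ ^ 2
  rw [Lp_enorm_sq]
  refine (lintegral_congr_ae hcoe).trans ((lintegral_enorm_sq_mul_prod
    (aestronglyMeasurable_const.indicator hI) hu2).trans ?_)
  rw [hind, huu]

/-- The contraction `(ℓ, t) ↦ ∫ K(ℓ, t, s) u(s) ds` of a field of kernels with `u`, that is, the
field of vectors to which the operators with these kernels map the conjugate of `u`. -/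
def contraction (p : (Fin m → ℝ) × (Fin d → ℝ)) : ℂ :=
  ∫ s, K (p.1, (p.2, s)) * u s

theorem measurable_contraction : Measurable (e.contraction u K) := by
  have hK := (Lp.stronglyMeasurable K).measurable.comp MeasurableEquiv.prodAssoc.measurable
  exact (hK.mul ((Lp.stronglyMeasurable u).measurable.comp
    measurable_snd)).stronglyMeasurable.integral_prod_right'.measurable

theorem lintegral_contraction_enorm_sq_le :
    ∫⁻ p, ‖e.contraction u K p‖ₑ ^ 2 ∂(e.plancherelMeasure.prod volume) ≤
      ‖K‖ₑ ^ 2 * ‖u‖ₑ ^ 2 := by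
  have mp := measurePreserving_prodAssoc_plane (d := d) e.plancherelMeasure
  have hK := (Lp.stronglyMeasurable K).measurable
  rw [Lp_enorm_sq, Lp_enorm_sq, ← mp.lintegral_comp (hK.enorm.pow_const 2)]
  exact lintegral_enorm_sq_integral_mul_le (hK.comp MeasurableEquiv.prodAssoc.measurable)
    (Lp.aestronglyMeasurable u)

theorem memLp_contraction : MemLp (e.contraction u K) 2 (e.plancherelMeasure.prod volume) :=
  memLp_two_of_lintegral_enorm_sq_le (e.measurable_contraction u K).aestronglyMeasurable
    (ENNReal.mul_ne_top (ENNReal.pow_ne_top enorm_ne_top) (ENNReal.pow_ne_top enorm_ne_top))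
    (e.lintegral_contraction_enorm_sq_le u K)

/-- The density `((ℓ, t), x) ↦ 1_I(ℓ) conj (u(t)) ∫ K(ℓ, t - x, s) u(s) ds` whose Fourier integral
in `(ℓ, t)` is the matrix coefficient of `kernelAction` at `K` and `1_I(ℓ) u ⊗ u`. -/
def coeffDensity (I : Set (Fin m → ℝ)) (p : ((Fin m → ℝ) × (Fin d → ℝ)) × (Fin d → ℝ)) : ℂ :=
  I.indicator (fun _ => 1) p.1.1 * (starRingEnd ℂ) (u p.1.2) *
    e.contraction u K (p.1.1, p.1.2 - p.2)

include hI in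
theorem measurable_coeffDensity : Measurable (e.coeffDensity u K I) := by
  have hu : Measurable u := (Lp.stronglyMeasurable u).measurable
  have hK := e.measurable_contraction u K
  exact (((measurable_const.indicator hI).comp measurable_fst.fst).mul
    (Complex.continuous_conj.measurable.comp (hu.comp measurable_fst.snd))).mul
    (hK.comp (by fun_prop))

theorem lintegral_coeffDensity_enorm_sq_le (I : Set (Fin m → ℝ)) :
    ∫⁻ p, ‖e.coeffDensity u K I p‖ₑ ^ 2 ∂((e.plancherelMeasure.prod volume).prod volume) ≤
      ‖u‖ₑ ^ 2 * (‖K‖ₑ ^ 2 * ‖u‖ₑ ^ 2) := by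
  have hle : ∀ p, ‖e.coeffDensity u K I p‖ₑ ^ 2 ≤
      ‖u p.1.2‖ₑ ^ 2 * ‖e.contraction u K (p.1.1, p.1.2 - p.2)‖ₑ ^ 2 := fun p => by
    by_cases hp : p.1.1 ∈ I <;> simp [coeffDensity, hp, mul_pow]
  refine (lintegral_mono hle).trans ?_
  rw [lintegral_prod_mul_comp_sub ((Lp.stronglyMeasurable u).measurable.enorm.pow_const 2)
    ((e.measurable_contraction u K).enorm.pow_const 2), ← Lp_enorm_sq]
  gcongr
  exact e.lintegral_contraction_enorm_sq_le u K

include hI hI' in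
theorem integrable_coeffDensity (x : Fin d → ℝ) :
    Integrable (fun p => e.coeffDensity u K I (p, x)) (e.plancherelMeasure.prod volume) := by
  have mp : MeasurePreserving (fun p : (Fin m → ℝ) × (Fin d → ℝ) => (p.1, p.2 - x))
      (e.plancherelMeasure.prod volume) (e.plancherelMeasure.prod volume) :=
    (MeasurePreserving.id _).prod (measurePreserving_sub_right volume x)
  exact (memLp_two_mul_prod (memLp_indicator_const 2 hI (1 : ℂ) (.inr hI'))
    (Lp.memLp u).star).integrable_mul ((e.memLp_contraction u K).comp_measurePreserving mp)

theorem inner_selfTensorField_kernelAction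
    (q : ((Fin m → ℝ) × (Fin d → ℝ)) × (Fin d → ℝ)) :
    inner ℂ (e.selfTensorField hI hI' u) (e.kernelAction q K) =
      ∫ p, pairChar (e.freqMap p) q.1 * e.coeffDensity u K I (p, q.2)
        ∂(e.plancherelMeasure.prod volume) := by
  have mp := measurePreserving_prodAssoc_plane (d := d) e.plancherelMeasure
  have hinner : (fun p => inner ℂ (e.selfTensorField hI hI' u p) (e.kernelAction q K p))
      =ᵐ[e.plancherelMeasure.prod volume] fun p =>
        pairChar (e.freqMap (p.1, p.2.1)) q.1 * (I.indicator (fun _ => 1) p.1 *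
          (starRingEnd ℂ) (u p.2.1) * (K (p.1, (p.2.1 - q.2, p.2.2)) * u p.2.2)) := by
    filter_upwards [e.coeFn_selfTensorField hI hI' u, e.coeFn_kernelAction q K] with p hP hact
    rw [RCLike.inner_apply, hP, hact]
    by_cases hp : p.1 ∈ I
    · simp only [hp, Set.indicator_of_mem, one_mul, map_mul, Complex.conj_conj]
      ring
    · simp [hp]
  have hi := (L2.integrable_inner (𝕜 := ℂ) (e.selfTensorField hI hI' u) (e.kernelAction q K)).congr
    hinner
  rw [L2.inner_def, integral_congr_ae hinner, ← mp.integral_comp' (g := fun p => _)]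
  refine (integral_prod _ (mp.integrable_comp_of_integrable hi)).trans ?_
  simp only [coeffDensity, contraction, ← integral_const_mul]
  rfl

variable [TwoStepLie 𝔫]

theorem inner_selfTensorField_kernelAction_eq_partialFourier
    (q : ((Fin m → ℝ) × (Fin d → ℝ)) × (Fin d → ℝ)) :
    inner ℂ (e.selfTensorField hI hI' u) (e.kernelAction q K) =
      partialFourier (fun r => e.coeffDensity u K I (e.freqInv r.1, r.2)) q := by
  have hm : Measurable fun p : (Fin m → ℝ) × (Fin d → ℝ) =>
      pairChar (e.freqMap p) q.1 * e.coeffDensity u K I (p, q.2) :=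
    (measurable_pairChar e.measurable_freqMap measurable_const).mul
      ((e.measurable_coeffDensity hI u K).comp measurable_prodMk_right)
  have hcross : ∀ᵐ w : (Fin m → ℝ) × (Fin d → ℝ), w.1 ∈ e.crossSection :=
    Measure.quasiMeasurePreserving_fst.ae e.ae_mem_crossSection
  rw [inner_selfTensorField_kernelAction, partialFourier, charIntegral,
    ← integral_comp_of_measurePreserving e.measurePreserving_freqInv hm.aestronglyMeasurable]
  refine integral_congr_ae ?_
  filter_upwards [hcross] with w hw
  rw [e.freqMap_freqInv hw, pairChar_comm]

theorem measurable_inner_selfTensorField_kernelAction :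
    Measurable fun q => inner ℂ (e.selfTensorField hI hI' u) (e.kernelAction q K) := by
  simp only [inner_selfTensorField_kernelAction_eq_partialFourier]
  exact measurable_partialFourier ((e.measurable_coeffDensity hI u K).comp
    ((e.measurable_freqInv.comp measurable_fst).prodMk measurable_snd))

theorem lintegral_inner_selfTensorField_kernelAction_le :
    ∫⁻ q, ‖inner ℂ (e.selfTensorField hI hI' u) (e.kernelAction q K)‖ₑ ^ 2 ≤
      ‖u‖ₑ ^ 2 * (‖K‖ₑ ^ 2 * ‖u‖ₑ ^ 2) := by
  have mp := e.measurePreserving_freqInv.prod (.id (volume : Measure (Fin d → ℝ)))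
  have hD := e.measurable_coeffDensity hI u K
  have hint : ∀ x, Integrable fun v => e.coeffDensity u K I (e.freqInv v, x) := fun x =>
    e.measurePreserving_freqInv.integrable_comp_of_integrable
      (e.integrable_coeffDensity hI hI' u K x)
  simp only [inner_selfTensorField_kernelAction_eq_partialFourier]
  refine (lintegral_partialFourier_enorm_sq_le (hD.comp mp.measurable) (.of_forall hint)).trans ?_
  refine Eq.trans_le ?_ (e.lintegral_coeffDensity_enorm_sq_le u K I)
  exact mp.lintegral_comp (hD.enorm.pow_const 2)

end AdaptedBasis

/-! ### A density theorem for Parseval frames of translates -/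

theorem tsum_setLIntegral_mul_right_le {G : Type*} [Group G] [MeasurableSpace G] {μ : Measure G}
    (hμ : ∀ g : G, MeasurePreserving (fun x => x * g) μ μ) {Γ : Set G} (hΓ : Γ.Countable)
    {s : Set G} (hs : MeasurableSet s) (hdisj : Γ.PairwiseDisjoint fun γ => (fun x => x * γ) '' s)
    {f : G → ℝ≥0∞} (hf : Measurable f) :
    ∑' γ : Γ, ∫⁻ x in s, f (x * γ) ∂μ ≤ ∫⁻ x, f x ∂μ := by
  have := hΓ.to_subtype
  have htrans (γ : G) : MeasurableSet ((fun x => x * γ) '' s) := by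
    rw [Set.image_mul_right]
    exact (hμ γ⁻¹).measurable hs
  calc ∑' γ : Γ, ∫⁻ x in s, f (x * γ) ∂μ
      = ∑' γ : Γ, ∫⁻ x in (fun x => x * (γ : G)) '' s, f x ∂μ := by
        refine tsum_congr fun γ => ?_
        rw [← (hμ γ).setLIntegral_comp_preimage (htrans γ) hf,
          Set.preimage_image_eq s (mul_left_injective (γ : G))]
    _ = ∫⁻ x in ⋃ γ : Γ, (fun x => x * (γ : G)) '' s, f x ∂μ :=
        (lintegral_iUnion (fun γ : Γ => htrans γ)
          (fun γ γ' h => hdisj γ.2 γ'.2 (Subtype.coe_ne_coe.2 h)) f).symm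
    _ ≤ ∫⁻ x, f x ∂μ := setLIntegral_le_lintegral _ _

namespace IsParsevalFrame

variable {E ι : Type*} [NormedAddCommGroup E] [InnerProductSpace ℂ E] {H : Submodule ℂ E}

theorem tsum_enorm_sq {f : ι → E} (hf : IsParsevalFrame H f) {x : E} (hx : x ∈ H) :
    ∑' i, ‖inner ℂ (f i) x‖ₑ ^ 2 = ‖x‖ₑ ^ 2 := by
  have h := hf.2 x hx
  simp only [← ofReal_norm, ← ENNReal.ofReal_pow (norm_nonneg _)]
  rw [← ENNReal.ofReal_tsum_of_nonneg (fun i => sq_nonneg _) h.summable, h.tsum_eq]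

theorem norm_le_one {f : ι → E} (hf : IsParsevalFrame H f) (i : ι) : ‖f i‖ ≤ 1 := by
  have h := le_hasSum (hf.2 (f i) (hf.1 i)) i fun _ _ => sq_nonneg _
  rw [inner_self_eq_norm_sq_to_K, norm_pow, RCLike.norm_ofReal, abs_norm, ← pow_mul] at h
  by_contra! hlt
  exact absurd h (not_le.2 (pow_lt_pow_right₀ hlt (by norm_num)))

theorem enorm_sq_mul_measure_le {G : Type*} [Group G] [MeasurableSpace G] {μ : Measure G}
    (hμ : ∀ g : G, MeasurePreserving (fun x => x * g) μ μ) {π : G →* (E →ₗᵢ[ℂ] E)}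
    (hπ : ∀ g, ∀ x ∈ H, π g x ∈ H) {Γ : Set G} (hΓ : Γ.Countable) {η : E}
    (hη : IsParsevalFrame H fun γ : Γ => π γ η) {s : Set G} (hs : MeasurableSet s)
    (hdisj : Γ.PairwiseDisjoint fun γ => (fun x => x * γ) '' s) {ψ : E} (hψ : ψ ∈ H)
    (hm : Measurable fun g => inner ℂ ψ (π g η)) :
    ‖ψ‖ₑ ^ 2 * μ s ≤ ∫⁻ g, ‖inner ℂ ψ (π g η)‖ₑ ^ 2 ∂μ := by
  have := hΓ.to_subtype
  have hm2 : Measurable fun g => ‖inner ℂ ψ (π g η)‖ₑ ^ 2 := hm.enorm.pow_const 2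
  have hinner (g γ : G) : ‖inner ℂ (π γ η) (π g⁻¹ ψ)‖ₑ = ‖inner ℂ ψ (π (g * γ) η)‖ₑ := by
    have hcancel : π g (π g⁻¹ ψ) = ψ := by
      rw [← Function.comp_apply (f := π g), ← LinearIsometry.coe_mul, ← map_mul, mul_inv_cancel,
        map_one, LinearIsometry.coe_one, id]
    rw [← (π g).inner_map_map, hcancel, map_mul, LinearIsometry.coe_mul, Function.comp_apply,
      ← inner_conj_symm, RCLike.enorm_conj]
  have hframe (g : G) : ∑' γ : Γ, ‖inner ℂ ψ (π (g * γ) η)‖ₑ ^ 2 = ‖ψ‖ₑ ^ 2 := by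
    simp only [← hinner]
    rw [hη.tsum_enorm_sq (hπ g⁻¹ ψ hψ), (π g⁻¹).enorm_map]
  calc ‖ψ‖ₑ ^ 2 * μ s = ∫⁻ g in s, ∑' γ : Γ, ‖inner ℂ ψ (π (g * γ) η)‖ₑ ^ 2 ∂μ := by
        simp only [hframe, setLIntegral_const]
    _ = ∑' γ : Γ, ∫⁻ g in s, ‖inner ℂ ψ (π (g * γ) η)‖ₑ ^ 2 ∂μ :=
        lintegral_tsum fun γ => (hm2.comp (hμ γ).measurable).aemeasurable
    _ ≤ ∫⁻ g, ‖inner ℂ ψ (π g η)‖ₑ ^ 2 ∂μ :=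
        tsum_setLIntegral_mul_right_le hμ hΓ hs hdisj hm2

end IsParsevalFrame

/-! ### The quasi-lattice and its fundamental domain -/

/-- The half-open box `∏ [0, 1 / c_k)`, a fundamental domain of the lattice `∏ (1 / c_k) ℤ`. -/
def latticeBox {n : ℕ} (c : Fin n → ℝ) : Set (Fin n → ℝ) :=
  Set.univ.pi fun k => Set.Ico 0 (1 / c k)

theorem measurableSet_latticeBox {n : ℕ} (c : Fin n → ℝ) : MeasurableSet (latticeBox c) :=
  .univ_pi fun _ => measurableSet_Ico

theorem volume_latticeBox {n : ℕ} {c : Fin n → ℝ} (hc : ∀ k, 0 < c k) :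
    volume (latticeBox c) = ENNReal.ofReal (∏ k, c k)⁻¹ := by
  rw [latticeBox, Real.volume_pi_Ico,
    ← ENNReal.ofReal_prod_of_nonneg fun k _ => by simpa using (hc k).le]
  simp

theorem eq_of_div_add_eq_div_add {n : ℕ} {c : Fin n → ℝ} (hc : ∀ k, 0 < c k)
    {x y : Fin n → ℝ} (hx : x ∈ latticeBox c) (hy : y ∈ latticeBox c) {i j : Fin n → ℤ}
    (h : (fun k => i k / c k) + x = (fun k => j k / c k) + y) : i = j := by
  have hfloor {z : Fin n → ℝ} (hz : z ∈ latticeBox c) (l : Fin n → ℤ) (k : Fin n) :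
      ⌊c k * (l k / c k + z k)⌋ = l k := by
    have hzk := hz k (Set.mem_univ k)
    have hfract : ⌊c k * z k⌋ = 0 :=
      Int.floor_eq_zero_iff.2 ⟨mul_nonneg (hc k).le hzk.1, (lt_div_iff₀' (hc k)).1 hzk.2⟩
    rw [mul_add, mul_div_cancel₀ _ (hc k).ne', Int.floor_intCast_add, hfract, add_zero]
  funext k
  rw [← hfloor hx i k, ← hfloor hy j k]
  exact congrArg (fun r => ⌊c k * r⌋) (congrFun h k)

namespace AdaptedBasis

variable {𝔫 : Type*} [LieRing 𝔫] [LieAlgebra ℝ 𝔫] [TwoStepLie 𝔫] {m d : ℕ}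
  (e : AdaptedBasis 𝔫 m d)

theorem quasiLattice_eq_range (a : Fin m → ℝ) (q b : Fin d → ℝ) :
    e.quasiLattice a q b = Set.range fun γ : ((Fin m → ℤ) × (Fin d → ℤ)) × (Fin d → ℤ) =>
      e.assocChart ((fun j => γ.1.1 j / a j, fun j => γ.1.2 j / q j), fun j => γ.2 j / b j) := by
  ext g
  constructor
  · rintro ⟨i, k, n, rfl⟩
    exact ⟨((i, k), n), rfl⟩
  · rintro ⟨γ, rfl⟩
    exact ⟨γ.1.1, γ.1.2, γ.2, rfl⟩

theorem countable_quasiLattice (a : Fin m → ℝ) (q b : Fin d → ℝ) :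
    (e.quasiLattice a q b).Countable := by
  rw [quasiLattice_eq_range]
  exact Set.countable_range _

theorem nonempty_quasiLattice (a : Fin m → ℝ) (q b : Fin d → ℝ) :
    (e.quasiLattice a q b).Nonempty := by
  rw [quasiLattice_eq_range]
  exact Set.range_nonempty _

/-- The set of all `exp (∑ z_k Z_k) exp (∑ y_j Y_j) exp (∑ x_j X_j)` with `z_k ∈ [0, 1 / a_k)`,
`y_j ∈ [0, 1 / q_j)`, `x_j ∈ [0, 1 / b_j)`, a fundamental domain of the quasi-lattice. -/
def fundamentalBox (a : Fin m → ℝ) (q b : Fin d → ℝ) : Set (NilGroup 𝔫) :=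
  e.assocChart '' ((latticeBox a ×ˢ latticeBox q) ×ˢ latticeBox b)

theorem measurableSet_fundamentalBox (a : Fin m → ℝ) (q b : Fin d → ℝ) :
    MeasurableSet (e.fundamentalBox a q b) :=
  e.assocChart.measurableSet_image.2 (((measurableSet_latticeBox a).prod
    (measurableSet_latticeBox q)).prod (measurableSet_latticeBox b))

theorem haar_fundamentalBox {a : Fin m → ℝ} {q b : Fin d → ℝ} (ha : ∀ k, 0 < a k)
    (hq : ∀ j, 0 < q j) (hb : ∀ j, 0 < b j) : e.haar (e.fundamentalBox a q b) =
      (ENNReal.ofReal ((∏ j, q j) * (∏ j, b j) * (∏ k, a k)))⁻¹ := by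
  have hpos {n : ℕ} {c : Fin n → ℝ} (hc : ∀ k, 0 < c k) : 0 < ∏ k, c k :=
    Finset.prod_pos fun k _ => hc k
  have hA := hpos ha
  have hQ := hpos hq
  have hB := hpos hb
  rw [← e.measurePreserving_assocChart.measure_preimage_equiv, fundamentalBox,
    Set.preimage_image_eq _ e.assocChart.injective, Measure.volume_eq_prod, Measure.prod_prod,
    Measure.volume_eq_prod, Measure.prod_prod, volume_latticeBox ha, volume_latticeBox hq,
    volume_latticeBox hb, ← ENNReal.ofReal_inv_of_pos (by positivity),
    ← ENNReal.ofReal_mul (by positivity), ← ENNReal.ofReal_mul (by positivity)]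
  congr 1
  ring

theorem pairwiseDisjoint_fundamentalBox_mul {a : Fin m → ℝ} {q b : Fin d → ℝ} (ha : ∀ k, 0 < a k)
    (hq : ∀ j, 0 < q j) (hb : ∀ j, 0 < b j) : (e.quasiLattice a q b).PairwiseDisjoint
      fun γ => (fun g => g * γ) '' e.fundamentalBox a q b := by
  rw [quasiLattice_eq_range]
  rintro _ ⟨⟨⟨i, k⟩, n⟩, rfl⟩ _ ⟨⟨⟨i', k'⟩, n'⟩, rfl⟩ hne
  refine Set.disjoint_left.2 ?_
  rintro _ ⟨_, ⟨⟨⟨z, y⟩, x⟩, ⟨⟨hz, hy⟩, hx⟩, rfl⟩, rfl⟩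
    ⟨_, ⟨⟨⟨z', y'⟩, x'⟩, ⟨⟨hz', hy'⟩, hx'⟩, rfl⟩, h⟩
  refine hne ?_
  simp only [assocChart_mul_assocChart, EmbeddingLike.apply_eq_iff_eq, Prod.mk.injEq] at h
  obtain ⟨hzy, hx_eq⟩ := h
  obtain ⟨hz_eq, hy_eq⟩ := Prod.mk.inj hzy
  obtain rfl := eq_of_div_add_eq_div_add hb hx' hx hx_eq
  obtain rfl := eq_of_div_add_eq_div_add hq hy' hy hy_eq
  obtain rfl := add_left_cancel hx_eq
  simp only [← add_assoc] at hz_eq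
  obtain rfl := eq_of_div_add_eq_div_add ha hz' hz (add_right_cancel hz_eq)
  rfl

theorem measurePreserving_mul_right (g : NilGroup 𝔫) :
    MeasurePreserving (fun n => n * g) e.haar e.haar := by
  obtain ⟨γ, rfl⟩ := e.assocChart.surjective g
  have hshift : Measurable fun x : Fin d → ℝ =>
      (γ.1.1 + e.zRepr ⁅e.xVec x, e.yVec γ.1.2⁆, γ.1.2) :=
    ((e.measurable_zRepr_lie.comp measurable_prodMk_right).const_add _).prodMk measurable_const
  have hT := measurePreserving_shear
    (ρ := (volume : Measure (Fin m → ℝ)).prod (volume : Measure (Fin d → ℝ)))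
    (measurePreserving_add_left volume γ.2) hshift
  have h := (e.measurePreserving_assocChart.comp hT).comp
    (MeasurePreserving.symm e.assocChart e.measurePreserving_assocChart)
  convert h using 1
  funext n
  obtain ⟨p, rfl⟩ := e.assocChart.surjective n
  simp only [assocChart_mul_assocChart, Function.comp_apply, MeasurableEquiv.symm_apply_apply]
  exact congrArg e.assocChart
    (Prod.ext (Prod.ext (add_left_comm _ _ _) (add_comm _ _)) rfl)

variable {I : Set (Fin m → ℝ)}

section MatrixCoefficient

variable {J : Set (Fin m → ℝ)} (hJ : MeasurableSet J) (hJ' : e.plancherelMeasure J ≠ ⊤)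
  {u : L2R d} {ψ η : e.L2N} {K : e.L2Sigma}
  (hψ : (ψ, e.selfTensorField hJ hJ' u) ∈ e.plancherelGraph) (hη : (η, K) ∈ e.plancherelGraph)

include hψ hη

theorem inner_leftRegular_assocChart (p : ((Fin m → ℝ) × (Fin d → ℝ)) × (Fin d → ℝ)) :
    inner ℂ ψ (e.leftRegular (e.assocChart p) η) =
      inner ℂ (e.selfTensorField hJ hJ' u) (e.kernelAction p K) :=
  (e.inner_eq_of_mem_plancherelGraph hψ (e.leftRegular_mem_plancherelGraph p hη)).symm

theorem measurable_inner_leftRegular : Measurable fun n => inner ℂ ψ (e.leftRegular n η) := by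
  rw [← e.assocChart.measurable_comp_iff]
  simp only [Function.comp_def, e.inner_leftRegular_assocChart hJ hJ' hψ hη]
  exact e.measurable_inner_selfTensorField_kernelAction hJ hJ' u K

theorem lintegral_inner_leftRegular_le :
    ∫⁻ n, ‖inner ℂ ψ (e.leftRegular n η)‖ₑ ^ 2 ∂e.haar ≤ ‖u‖ₑ ^ 2 * (‖η‖ₑ ^ 2 * ‖u‖ₑ ^ 2) := by
  have hK : ‖K‖ₑ = ‖η‖ₑ := by
    rw [← ofReal_norm, ← ofReal_norm, e.norm_eq_of_mem_plancherelGraph hη]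
  rw [← e.measurePreserving_assocChart.lintegral_comp_emb e.assocChart.measurableEmbedding]
  simp only [e.inner_leftRegular_assocChart hJ hJ' hψ hη]
  exact hK ▸ e.lintegral_inner_selfTensorField_kernelAction_le hJ hJ' u K

end MatrixCoefficient

variable {u : L2R d} (hu : ‖u‖ = 1) {Γ : Set (NilGroup 𝔫)} (hΓ : Γ.Countable) (hΓ' : Γ.Nonempty)
  {η : e.L2N} (hη : IsParsevalFrame (e.bandLimitedSpace I u) fun γ : Γ => e.leftRegular γ η)
  {s : Set (NilGroup 𝔫)} (hs : MeasurableSet s)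
  (hdisj : Γ.PairwiseDisjoint fun γ => (fun g => g * γ) '' s)

include hu hΓ hΓ' hη hs hdisj

theorem plancherelMeasure_mul_haar_le_one_of_subset {J : Set (Fin m → ℝ)} (hJ : MeasurableSet J)
    (hJ' : e.plancherelMeasure J ≠ ⊤) (hJI : J ⊆ I) : e.plancherelMeasure J * e.haar s ≤ 1 := by
  have hu' : ‖u‖ₑ = 1 := by rw [← ofReal_norm, hu, ENNReal.ofReal_one]
  obtain ⟨ψ, hψ⟩ := e.exists_mem_plancherelGraph (e.selfTensorField hJ hJ' u)
  have hψI : ψ ∈ e.bandLimitedSpace I u :=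
    ⟨(ψ, _), ⟨hψ, e.selfTensorField_mem_rankOneField hJ hJ' u hJI⟩, rfl⟩
  have hψ_norm : ‖ψ‖ₑ ^ 2 = e.plancherelMeasure J := by
    rw [← ofReal_norm, ← e.norm_eq_of_mem_plancherelGraph hψ, ofReal_norm,
      enorm_sq_selfTensorField, hu', one_pow, one_mul, mul_one]
  obtain ⟨γ, hγ⟩ := hΓ'
  have hηI : η ∈ e.bandLimitedSpace I u := by
    have h := e.leftRegular_mem_bandLimitedSpace γ⁻¹ (hη.1 ⟨γ, hγ⟩)
    change (e.leftRegularHom γ⁻¹ * e.leftRegularHom γ) η ∈ _ at h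
    rwa [← map_mul, inv_mul_cancel, map_one] at h
  have hη_norm : ‖η‖ₑ ≤ 1 := by
    rw [← (e.leftRegular γ).enorm_map, ← ofReal_norm]
    exact ENNReal.ofReal_le_one.2 (hη.norm_le_one ⟨γ, hγ⟩)
  obtain ⟨⟨_, K⟩, ⟨hK, _⟩, rfl⟩ := hηI
  calc e.plancherelMeasure J * e.haar s = ‖ψ‖ₑ ^ 2 * e.haar s := by rw [hψ_norm]
    _ ≤ ∫⁻ n, ‖inner ℂ ψ (e.leftRegular n _)‖ₑ ^ 2 ∂e.haar :=
        IsParsevalFrame.enorm_sq_mul_measure_le e.measurePreserving_mul_right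
          (π := e.leftRegularHom) (fun g _ => e.leftRegular_mem_bandLimitedSpace g) hΓ hη hs hdisj
          hψI (e.measurable_inner_leftRegular hJ hJ' hψ hK)
    _ ≤ ‖u‖ₑ ^ 2 * (‖_‖ₑ ^ 2 * ‖u‖ₑ ^ 2) := e.lintegral_inner_leftRegular_le hJ hJ' hψ hK
    _ ≤ 1 := by
        rw [hu', one_pow, one_mul, mul_one]
        exact pow_le_one₀ zero_le hη_norm

theorem plancherelMeasure_mul_haar_le_one (hI : MeasurableSet I) :
    e.plancherelMeasure I * e.haar s ≤ 1 := by
  rw [← Measure.iSup_restrict_spanningSets (μ := e.plancherelMeasure), ENNReal.iSup_mul]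
  refine iSup_le fun i => ?_
  rw [Measure.restrict_apply hI]
  exact e.plancherelMeasure_mul_haar_le_one_of_subset hu hΓ hΓ' hη hs hdisj
    (hI.inter (measurableSet_spanningSets _ i))
    (measure_inter_lt_top_of_right_ne_top (measure_spanningSets_lt_top _ i).ne).ne
    Set.inter_subset_left

end AdaptedBasis

end

theorem mainTheorem7_general {𝔫 : Type*} [LieRing 𝔫] [LieAlgebra ℝ 𝔫] [TwoStepLie 𝔫] {m d : ℕ}
    (e : AdaptedBasis 𝔫 m d) (a : Fin m → ℝ) (q b : Fin d → ℝ)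
    (ha : ∀ k, 0 < a k) (hq : ∀ j, 0 < q j) (hb : ∀ j, 0 < b j)
    (I : Set (Fin m → ℝ)) (hI : MeasurableSet I) (u : AdaptedBasis.L2R d) (hu : ‖u‖ = 1)
    (hη : ∃ η : e.L2N, IsParsevalFrame (e.bandLimitedSpace I u)
      (fun γ : e.quasiLattice a q b => e.leftRegular γ η)) :
    e.plancherelMeasure I ≤ ENNReal.ofReal ((∏ j, q j) * (∏ j, b j) * (∏ k, a k)) := by
  obtain ⟨η, hη⟩ := hη
  have h := e.plancherelMeasure_mul_haar_le_one hu (e.countable_quasiLattice a q b)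
    (e.nonempty_quasiLattice a q b) hη (e.measurableSet_fundamentalBox a q b)
    (e.pairwiseDisjoint_fundamentalBox_mul ha hq hb) hI
  rw [e.haar_fundamentalBox ha hq hb] at h
  exact (ENNReal.le_inv_iff_mul_le.2 h).trans_eq (inv_inv _)

theorem mainTheorem7 {𝔫 : Type*} [LieRing 𝔫] [LieAlgebra ℝ 𝔫] [TwoStepLie 𝔫] {m d : ℕ}
    (hd : 1 ≤ d) (e : AdaptedBasis 𝔫 m d)
    (a : Fin m → ℝ) (q b : Fin d → ℝ)
    (ha : ∀ k, 0 < a k) (hq : ∀ j, 0 < q j) (hb : ∀ j, 0 < b j)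
    (I : Set (Fin m → ℝ)) (hI : MeasurableSet I)
    (hIS : I ⊆ e.crossSection) (hIa : ∀ ℓ ∈ I, ∀ k, 0 ≤ ℓ k ∧ ℓ k ≤ a k)
    (u : AdaptedBasis.L2R d) (hu : ‖u‖ = 1)
    (hη : ∃ η : e.L2N, IsParsevalFrame (e.bandLimitedSpace I u)
      (fun γ : e.quasiLattice a q b => e.leftRegular γ η)) :
    e.plancherelMeasure I ≤ ENNReal.ofReal ((∏ j, q j) * (∏ j, b j) * (∏ k, a k)) :=
  mainTheorem7_general e a q b ha hq hb I hI u hu hη
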